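/- Let $d\ge 0$ be an integer and $m\ge 0$, and write $\langle x\rangle=(1+|x|^2)^{1/2}$. Call $A\in C^\infty(\mathbb R^d;\mathbb R^d)$ *tempered* if there is $\tau\ge0$ such that for every multi-index $\beta$ there is a constant $C_\beta$ with $|\partial^\beta A(x)|\le C_\beta\langle x\rangle^{\tau}$ for all $x\in\mathbb R^d$. The oscillatory integral $\mathrm{Os}\text{-}\!\iint e^{-iy\cdot\eta}a(\eta,y)\,dy\,d\eta$ is the limit as $\varepsilon\to0+$ of the absolutely convergent integrals $\iint e^{-iy\cdot\eta}\chi(\varepsilon\eta,\varepsilon y)a(\eta,y)\,dy\,d\eta$, provided that these integrals converge absolutely and the limit exists for every $\chi\in\mathcal S(\mathbb R^d\times\mathbb R^d)$ with $\chi(0,0)=1$, and does not depend on $\chi$. For tempered $A$, $f\in C_0^\infty(\mathbb R^d)$ and $x\in\mathbb R^d$ put $$(H_A^{(1)}f)(x)=\frac1{(2\pi)^d}\,\mathrm{Os}\text{-}\!\iint e^{i(x-y)\cdot\xi}\sqrt{\Big(\xi-A\big(\tfrac{x+y}2\big)\Big)^2+m^2}\;f(y)\,dy\,d\xi,$$ $$(H_A^{(2)}f)(x)=\frac1{(2\pi)^d}\,\mathrm{Os}\text{-}\!\iint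 e^{i(x-y)\cdot\xi}\sqrt{\Big(\xi-\int_0^1A((1-\theta)x+\theta y)\,d\theta\Big)^2+m^2}\;f(y)\,dy\,d\xi,$$ where the integrals are oscillatory integrals in the variables $(\xi,y-x)$. For $A\in L^2_{\rm loc}(\mathbb R^d;\mathbb R^d)$ let $(-i\nabla-A)^2+m^2$ be the operator in $L^2(\mathbb R^d)$ associated with the quadratic form $\|(-i\nabla-A)u\|^2+m^2\|u\|^2$ with form domain $\{u\in L^2(\mathbb R^d):(-i\nabla-A)u\in L^2\}$ (derivatives in the sense of distributions), and let $H_A^{(3)}=\sqrt{(-i\nabla-A)^2+m^2}$ be its nonnegative selfadjoint square root. Then these operators are well defined: for tempered $A$, all $f\in C_0^\infty(\mathbb R^d)$ and all $x$, the two oscillatory integrals exist, and for $A\in L^2_{\rm loc}$ the operator $(-i\nabla-A)^2+m^2$ has exactly one nonnegative selfadjoint square root. Moreover: 1. For all tempered $A$ and all real-valued $\varphi\in\mathcal S(\mathbb R^d)$, $H^{(2)}_{A+\nabla\varphi}f=e^{i\varphi}H^{(2)}_A(e^{-i\varphi}f)$ for every $f\in C_0^\infty(\mathbb R^d)$. 2.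 For all $A\in L^2_{\rm loc}(\mathbb R^d;\mathbb R^d)$ and all real-valued $\varphi\in\mathcal S(\mathbb R^d)$, $H^{(3)}_{A+\nabla\varphi}=e^{i\varphi}H^{(3)}_Ae^{-i\varphi}$ as (unbounded) operators in $L^2(\mathbb R^d)$, including equality of domains. 3. $H^{(1)}_A$ is not gauge covariant: if $d\ge1$, then for every tempered $A$ there are a real-valued $\varphi\in\mathcal S(\mathbb R^d)$ and an $f\in C_0^\infty(\mathbb R^d)$ such that $H^{(1)}_{A+\nabla\varphi}f\ne e^{i\varphi}H^{(1)}_A(e^{-i\varphi}f)$. -/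

import Mathlib

open MeasureTheory Filter Topology Complex
open scoped ContDiff SchwartzMap InnerProductSpace

noncomputable section

namespace MagRel

/-- The space `ℝ^d` with its Euclidean norm. -/
abbrev E (d : ℕ) : Type := EuclideanSpace ℝ (Fin d)

/-- The complex Hilbert space `L²(ℝ^d)`. -/
abbrev L2 (d : ℕ) : Type := Lp ℂ 2 (volume : Measure (E d))

/-- `f ∈ C₀^∞(ℝ^d)`, complex valued. -/
def IsTest {d : ℕ} (f : E d → ℂ) : Prop :=
  ContDiff ℝ ∞ f ∧ HasCompactSupport f

/-- Smooth vector potentials all of whose derivatives satisfy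
`|∂^β A(x)| ≤ C_β ⟨x⟩^τ`, with one exponent `τ ≥ 0` for all orders. -/
def IsTemperate {d : ℕ} (A : E d → E d) : Prop :=
  ContDiff ℝ ∞ A ∧
    ∃ τ : ℝ, 0 ≤ τ ∧ ∀ n : ℕ, ∃ C : ℝ, ∀ x : E d,
      ‖iteratedFDeriv ℝ n A x‖ ≤ C * (1 + ‖x‖ ^ 2) ^ (τ / 2)

/-- `A ∈ L²_loc(ℝ^d; ℝ^d)`. -/
def IsL2Loc {d : ℕ} (A : E d → E d) : Prop :=
  ∀ K : Set (E d), IsCompact K → MemLp A 2 (volume.restrict K)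

/-- The gauge transformed potential `A + ∇φ`. -/
def gauge {d : ℕ} (A : E d → E d) (φ : 𝓢(E d, ℝ)) : E d → E d :=
  fun x => A x + gradient (fun z => φ z) x

/-! ### Oscillatory integrals and the two pseudo-differential operators -/

/-- `L` is the value of the oscillatory integral `Os-∬ e^{-i y·η} a(η, y) dy dη`: for every
cutoff `χ ∈ 𝓢(ℝ^d × ℝ^d)` with `χ(0,0) = 1` the regularized integrals converge absolutely and
tend to `L` as `ε → 0+`. -/
def HasOscIntegral {d : ℕ} (a : E d → E d → ℂ) (L : ℂ) : Prop :=
  ∀ χ : 𝓢(E d × E d, ℂ), χ (0, 0) = 1 →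
    (∀ ε : ℝ, 0 < ε → Integrable (fun p : E d × E d =>
        cexp (-I * ((⟪p.2, p.1⟫_ℝ : ℝ) : ℂ)) * χ (ε • p.1, ε • p.2) * a p.1 p.2)) ∧
    Tendsto (fun ε : ℝ => ∫ p : E d × E d,
        cexp (-I * ((⟪p.2, p.1⟫_ℝ : ℝ) : ℂ)) * χ (ε • p.1, ε • p.2) * a p.1 p.2)
      (𝓝[>] 0) (𝓝 L)

/-- The value of the oscillatory integral (and `0` if it does not exist). -/
def oscIntegral {d : ℕ} (a : E d → E d → ℂ) : ℂ :=
  open Classical in if h : ∃ L, HasOscIntegral a L then h.choose else 0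

/-- The midpoint prescription `A((x+y)/2)`. -/
def midA {d : ℕ} (A : E d → E d) (x y : E d) : E d :=
  A ((1 / 2 : ℝ) • (x + y))

/-- The averaged prescription `∫₀¹ A((1-θ)x + θy) dθ`. -/
def avgA {d : ℕ} (A : E d → E d) (x y : E d) : E d :=
  ∫ θ in (0 : ℝ)..1, A ((1 - θ) • x + θ • y)

/-- The amplitude `√((ξ - B(x,y'))² + m²) f(y')`, where `y' = x + y`, so that
`e^{i(x-y')·ξ} = e^{-iy·ξ}`. -/
def amplitude {d : ℕ} (m : ℝ) (B : E d → E d → E d) (f : E d → ℂ) (x : E d) :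
    E d → E d → ℂ :=
  fun ξ y => ((Real.sqrt (‖ξ - B x (x + y)‖ ^ 2 + m ^ 2) : ℝ) : ℂ) * f (x + y)

/-- `(2π)^{-d} Os-∬ e^{i(x-y)·ξ} √((ξ - B(x,y))² + m²) f(y) dy dξ`. -/
def pseudoDiff {d : ℕ} (m : ℝ) (B : E d → E d → E d) (f : E d → ℂ) (x : E d) : ℂ :=
  (((2 * Real.pi) ^ d : ℝ) : ℂ)⁻¹ * oscIntegral (amplitude m B f x)

/-- The Weyl operator `H_A^{(1)}`. -/
def H1 {d : ℕ} (m : ℝ) (A : E d → E d) (f : E d → ℂ) : E d → ℂ :=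
  pseudoDiff m (midA A) f

/-- The modified operator `H_A^{(2)}`. -/
def H2 {d : ℕ} (m : ℝ) (A : E d → E d) (f : E d → ℂ) : E d → ℂ :=
  pseudoDiff m (avgA A) f

/-- `e^{iφ} f` for a function `f`. -/
def mulPhase {d : ℕ} (φ : 𝓢(E d, ℝ)) (f : E d → ℂ) : E d → ℂ :=
  fun x => cexp (I * ((φ x : ℝ) : ℂ)) * f x

/-! ### The square root of the magnetic Schrödinger operator -/

/-- `(-i∂_j - A_j) u = v` in the sense of distributions, for `u, v ∈ L²`. The integrability
clause says that the left-hand side is a distribution; it is automatic for `A ∈ L²_loc`. -/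
def IsMagDeriv {d : ℕ} (A : E d → E d) (j : Fin d) (u v : L2 d) : Prop :=
  ∀ ψ : E d → ℂ, IsTest ψ →
    Integrable (fun x => u x *
      (I * fderiv ℝ ψ x (EuclideanSpace.single j 1) - ((A x j : ℝ) : ℂ) * ψ x)) ∧
    ∫ x, u x * (I * fderiv ℝ ψ x (EuclideanSpace.single j 1) - ((A x j : ℝ) : ℂ) * ψ x) =
      ∫ x, v x * ψ x

theorem integrable_mul_test {d : ℕ} (v : L2 d) {ψ : E d → ℂ} (hψ : IsTest ψ) :
    Integrable (fun x => v x * ψ x) := by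
  have h2 : MemLp ψ 2 (volume : Measure (E d)) :=
    hψ.1.continuous.memLp_of_hasCompactSupport hψ.2
  exact (Lp.memLp v).integrable_mul h2

theorem IsMagDeriv.zero {d : ℕ} (A : E d → E d) (j : Fin d) : IsMagDeriv A j 0 0 := by
  intro ψ _
  have h0 : ∀ g : E d → ℂ, (fun x => (0 : L2 d) x * g x) =ᵐ[volume] fun _ => 0 := by
    intro g
    filter_upwards [Lp.coeFn_zero ℂ 2 (volume : Measure (E d))] with x hx
    rw [hx, Pi.zero_apply, zero_mul]
  refine ⟨(integrable_zero _ _ _).congr (h0 _).symm, ?_⟩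
  rw [integral_congr_ae (h0 _), integral_congr_ae (h0 ψ)]

theorem IsMagDeriv.add {d : ℕ} {A : E d → E d} {j : Fin d} {u v u' v' : L2 d}
    (h : IsMagDeriv A j u v) (h' : IsMagDeriv A j u' v') :
    IsMagDeriv A j (u + u') (v + v') := by
  intro ψ hψ
  have h0 : ∀ (a b : L2 d) (g : E d → ℂ),
      (fun x => (a + b : L2 d) x * g x) =ᵐ[volume] fun x => a x * g x + b x * g x := by
    intro a b g
    filter_upwards [Lp.coeFn_add a b] with x hx
    rw [hx, Pi.add_apply, add_mul]
  obtain ⟨h1, h2⟩ := h ψ hψ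
  obtain ⟨h1', h2'⟩ := h' ψ hψ
  refine ⟨(h1.add h1').congr (h0 _ _ _).symm, ?_⟩
  rw [integral_congr_ae (h0 _ _ _), integral_congr_ae (h0 v v' ψ), integral_add h1 h1',
    integral_add (integrable_mul_test v hψ) (integrable_mul_test v' hψ), h2, h2']

theorem IsMagDeriv.smul {d : ℕ} {A : E d → E d} {j : Fin d} {u v : L2 d} (c : ℂ)
    (h : IsMagDeriv A j u v) : IsMagDeriv A j (c • u) (c • v) := by
  intro ψ hψ
  have h0 : ∀ (a : L2 d) (g : E d → ℂ),
      (fun x => (c • a : L2 d) x * g x) =ᵐ[volume] fun x => c * (a x * g x) := by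
    intro a g
    filter_upwards [Lp.coeFn_smul c a] with x hx
    rw [hx, Pi.smul_apply, smul_eq_mul, mul_assoc]
  obtain ⟨h1, h2⟩ := h ψ hψ
  refine ⟨(h1.const_mul c).congr (h0 _ _).symm, ?_⟩
  rw [integral_congr_ae (h0 _ _), integral_congr_ae (h0 v ψ), integral_const_mul,
    integral_const_mul, h2]

/-- The graph of the operator `(-i∇-A)² + m²` in `L²(ℝ^d)` that belongs to the quadratic form
`h[v,u] = ∑_j ⟪(-i∂_j-A_j)v, (-i∂_j-A_j)u⟫ + m²⟪v,u⟫` with form domain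
`{u ∈ L² | (-i∇-A)u ∈ L²}`: the pairs `(u,w)` with `u` in the form domain and
`h[v,u] = ⟪v,w⟫` for all `v` in the form domain. -/
def magGraph {d : ℕ} (m : ℝ) (A : E d → E d) : Submodule ℂ (L2 d × L2 d) where
  carrier := {z | ∃ p : Fin d → L2 d, (∀ j, IsMagDeriv A j z.1 (p j)) ∧
    ∀ (v : L2 d) (q : Fin d → L2 d), (∀ j, IsMagDeriv A j v (q j)) →
      ∑ j, ⟪q j, p j⟫_ℂ + ((m ^ 2 : ℝ) : ℂ) * ⟪v, z.1⟫_ℂ = ⟪v, z.2⟫_ℂ}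
  zero_mem' := ⟨0, fun j => IsMagDeriv.zero A j, fun v q _ => by simp⟩
  add_mem' := by
    rintro ⟨u, w⟩ ⟨u', w'⟩ ⟨p, hp, h⟩ ⟨p', hp', h'⟩
    refine ⟨p + p', fun j => (hp j).add (hp' j), fun v q hq => ?_⟩
    have e := h v q hq
    have e' := h' v q hq
    simp only [Prod.mk_add_mk, Pi.add_apply, inner_add_right, Finset.sum_add_distrib] at e e' ⊢
    rw [← e, ← e']
    ring
  smul_mem' := by
    rintro c ⟨u, w⟩ ⟨p, hp, h⟩
    refine ⟨c • p, fun j => (hp j).smul c, fun v q hq => ?_⟩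
    have e := h v q hq
    simp only [Prod.smul_mk, Pi.smul_apply, inner_smul_right, ← Finset.mul_sum] at e ⊢
    rw [← e]
    ring

/-- `S` is a nonnegative selfadjoint square root of the operator with graph `G`:
`S* = S ≥ 0`, and `G` is the graph of `S ∘ S` on its natural domain. -/
def IsNonnegSqrt {d : ℕ} (S : L2 d →ₗ.[ℂ] L2 d) (G : Submodule ℂ (L2 d × L2 d)) : Prop :=
  Dense (S.domain : Set (L2 d)) ∧ IsSelfAdjoint S ∧
    (∀ u : S.domain, 0 ≤ (⟪(u : L2 d), S u⟫_ℂ).re) ∧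
    ∀ u w : L2 d, (u, w) ∈ G ↔ ∃ v : L2 d, (u, v) ∈ S.graph ∧ (v, w) ∈ S.graph

/-- `H_A^{(3)} = √((-i∇-A)² + m²)`, the nonnegative selfadjoint square root. -/
def H3 {d : ℕ} (m : ℝ) (A : E d → E d) : L2 d →ₗ.[ℂ] L2 d :=
  Classical.epsilon fun S => IsNonnegSqrt S (magGraph m A)

theorem memLp_mulPhase {d : ℕ} (φ : 𝓢(E d, ℝ)) (u : L2 d) :
    MemLp (mulPhase φ u) 2 (volume : Measure (E d)) := by
  have hc : Continuous fun x : E d => cexp (I * ((φ x : ℝ) : ℂ)) := by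
    have := φ.continuous
    fun_prop
  refine (Lp.memLp u).of_le (hc.aestronglyMeasurable.mul (Lp.aestronglyMeasurable u)) ?_
  refine Eventually.of_forall fun x => ?_
  simp [mulPhase, mul_comm I, Complex.norm_exp_ofReal_mul_I]

/-- The multiplication operator `e^{iφ}` on `L²(ℝ^d)`. -/
def phaseOp {d : ℕ} (φ : 𝓢(E d, ℝ)) : L2 d →ₗ[ℂ] L2 d where
  toFun u := (memLp_mulPhase φ u).toLp
  map_add' u v := by
    rw [← MemLp.toLp_add]
    refine MemLp.toLp_congr _ _ ?_
    filter_upwards [Lp.coeFn_add u v] with x hx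
    simp only [mulPhase, Pi.add_apply]
    rw [hx, Pi.add_apply, mul_add]
  map_smul' c u := by
    rw [RingHom.id_apply, ← MemLp.toLp_const_smul]
    refine MemLp.toLp_congr _ _ ?_
    filter_upwards [Lp.coeFn_smul c u] with x hx
    simp only [mulPhase, Pi.smul_apply, smul_eq_mul]
    rw [hx, Pi.smul_apply, smul_eq_mul, mul_left_comm]

/-- The operator `e^{iφ} S e^{-iφ}` with domain `{u | e^{-iφ}u ∈ D(S)}`. -/
def gaugeConj {d : ℕ} (φ : 𝓢(E d, ℝ)) (S : L2 d →ₗ.[ℂ] L2 d) : L2 d →ₗ.[ℂ] L2 d where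
  domain := S.domain.comap (phaseOp (-φ))
  toFun := phaseOp φ ∘ₗ S.toFun ∘ₗ (phaseOp (-φ)).restrict (fun _ hu => hu)

end MagRel

end

noncomputable section

/-!
`H_A^{(3)}`: for the closed operator `T u = (m u, (-i∇ - A) u)`, the orthogonal projection onto the
graph of `T` yields `R = (1 + T*T)⁻¹ ≥ 0` (von Neumann), and the square root of `T*T` is `b a⁻¹`
with `a = √R` and `b = √(1 - R)`. Uniqueness follows from uniqueness of positive square roots of
bounded operators, and uniqueness turns unitary equivalence of the squares under `e^{iφ}` into
gauge covariance of the roots.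

`H_A^{(1)}` and `H_A^{(2)}`: with the base point `x` fixed and `y` the displacement from it, the
shear `ξ = ζ + B(y)` removes the potential from the symbol, so the regularized integrals converge
to the value at the origin of `√(-Δ + m²)` applied to `y ↦ e^{-i⟨y, B(y)⟩} f(x + y)`. For the
averaged potential, `⟨y, B(y)⟩` is the line integral of `A` along the segment from `x` to `x + y`;
adding `∇φ` to `A` changes it by `φ(x + y) - φ(x)`, which is gauge covariance. The midpoint
potential only sees `∇φ` at `x + y / 2`: if `∇φ` vanishes there for all `x + y` in the support of
`f`, while `φ` is a nonzero constant on that support and vanishes at `x`, then covariance would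
force `√(-Δ + m²)` to be local. It is not, as its kernel is negative off the diagonal, by
subordination to the heat semigroup.
-/

namespace MagRel

open scoped FourierTransform

/-! ### Nonnegative selfadjoint square roots in a Hilbert space -/

section SquareRoot

variable {H : Type*} [NormedAddCommGroup H] [InnerProductSpace ℂ H]

theorem inner_apply_comm_of_nonneg {a : H →L[ℂ] H} (ha : 0 ≤ a) (x y : H) :
    ⟪a x, y⟫_ℂ = ⟪x, a y⟫_ℂ :=
  ((ContinuousLinearMap.nonneg_iff_isPositive a).1 ha).isSymmetric x y

theorem denseRange_of_nonneg_of_injective [CompleteSpace H] {a : H →L[ℂ] H} (ha : 0 ≤ a)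
    (hinj : Function.Injective a) : DenseRange a := by
  change Dense (LinearMap.range (a : H →ₗ[ℂ] H) : Set H)
  rw [Submodule.dense_iff_topologicalClosure_eq_top, Submodule.topologicalClosure_eq_top_iff,
    Submodule.eq_bot_iff]
  intro x hx
  refine hinj ((ext_inner_left ℂ fun y => ?_).trans (map_zero a).symm)
  rw [← inner_apply_comm_of_nonneg ha, inner_zero_right]
  exact (Submodule.mem_orthogonal _ _).1 hx _ ⟨y, rfl⟩

theorem isSelfAdjoint_iff_adjoint_graph_eq [CompleteSpace H] {S : H →ₗ.[ℂ] H}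
    (hS : Dense (S.domain : Set H)) : IsSelfAdjoint S ↔ S.graph.adjoint = S.graph := by
  rw [LinearPMap.isSelfAdjoint_def, ← LinearPMap.adjoint_graph_eq_graph_adjoint hS]
  exact ⟨congrArg _, LinearPMap.eq_of_eq_graph⟩

/-- `S = S* ≥ 0`, and the linear relation `G` is the graph of `S ∘ S`: the notion
`IsNonnegSqrt` in an arbitrary Hilbert space. -/
structure IsGraphSqrt [CompleteSpace H] (S : H →ₗ.[ℂ] H) (G : Submodule ℂ (H × H)) : Prop where
  dense_domain : Dense (S.domain : Set H)
  isSelfAdjoint : IsSelfAdjoint S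
  nonneg : ∀ u : S.domain, 0 ≤ (⟪(u : H), S u⟫_ℂ).re
  mem_iff : ∀ u w : H, (u, w) ∈ G ↔ ∃ v : H, (u, v) ∈ S.graph ∧ (v, w) ∈ S.graph

/-- The bounded transform of a positive selfadjoint operator `T`: the pair
`a = (1 + T²)^{-1/2}`, `b = T (1 + T²)^{-1/2}`, from which `T` is recovered as `b a⁻¹`. -/
structure IsBoundedTransform (a b : H →L[ℂ] H) : Prop where
  nonneg_left : 0 ≤ a
  nonneg_right : 0 ≤ b
  commute : Commute a b
  mul_self_add : a * a + b * b = 1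
  injective : Function.Injective a

/-- The unbounded operator `b a⁻¹`, whose graph is `{(a v, b v)}`. -/
def ratioOp (a b : H →L[ℂ] H) : H →ₗ.[ℂ] H :=
  (LinearMap.range ((a : H →ₗ[ℂ] H).prod (b : H →ₗ[ℂ] H))).toLinearPMap

namespace IsBoundedTransform

variable {a b : H →L[ℂ] H}

theorem apply_comm (h : IsBoundedTransform a b) (x : H) : a (b x) = b (a x) :=
  DFunLike.congr_fun h.commute.eq x

theorem apply_apply_add (h : IsBoundedTransform a b) (x : H) : a (a x) + b (b x) = x :=
  DFunLike.congr_fun h.mul_self_add x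

theorem mem_graph (h : IsBoundedTransform a b) {x y : H} :
    (x, y) ∈ (ratioOp a b).graph ↔ ∃ v, a v = x ∧ b v = y := by
  rw [ratioOp, Submodule.toLinearPMap_graph_eq]
  · simp
  · rintro ⟨x, y⟩ ⟨v, hv⟩ (rfl : x = 0)
    obtain ⟨hav, rfl⟩ := Prod.ext_iff.1 hv
    have hv0 : v = 0 := h.injective (hav.trans (map_zero a).symm)
    simp [hv0]

theorem exists_mem_graph_iff (h : IsBoundedTransform a b) {u w : H} :
    (∃ v, (u, v) ∈ (ratioOp a b).graph ∧ (v, w) ∈ (ratioOp a b).graph) ↔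
      a (a (u + w)) = u := by
  simp only [h.mem_graph]
  constructor
  · rintro ⟨_, ⟨p, rfl, rfl⟩, q, haq, rfl⟩
    rw [map_add a, h.apply_comm, haq, h.apply_apply_add]
  · intro hu
    refine ⟨b (a (u + w)), ⟨a (u + w), hu, rfl⟩, b (u + w), h.apply_comm _, ?_⟩
    have huw := h.apply_apply_add (u + w)
    rw [hu] at huw
    exact add_left_cancel huw

variable [CompleteSpace H]

theorem dense_domain (h : IsBoundedTransform a b) : Dense ((ratioOp a b).domain : Set H) := by
  refine (denseRange_of_nonneg_of_injective h.nonneg_left h.injective).mono ?_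
  rintro _ ⟨v, rfl⟩
  exact LinearPMap.mem_domain_of_mem_graph (h.mem_graph.2 ⟨v, rfl, rfl⟩)

theorem isSelfAdjoint (h : IsBoundedTransform a b) : IsSelfAdjoint (ratioOp a b) := by
  rw [isSelfAdjoint_iff_adjoint_graph_eq h.dense_domain]
  ext ⟨x, y⟩
  rw [Submodule.mem_adjoint_iff, h.mem_graph]
  constructor
  · intro hxy
    have hbx : b x = a y := by
      refine ext_inner_left ℂ fun v => ?_
      rw [← inner_apply_comm_of_nonneg h.nonneg_right, ← inner_apply_comm_of_nonneg h.nonneg_left]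
      exact sub_eq_zero.1 (hxy _ _ (h.mem_graph.2 ⟨v, rfl, rfl⟩))
    exact ⟨a x + b y, by rw [map_add, h.apply_comm, ← hbx, h.apply_apply_add],
      by rw [map_add, ← h.apply_comm, hbx, h.apply_apply_add]⟩
  · rintro ⟨v, rfl, rfl⟩ u w huw
    obtain ⟨z, rfl, rfl⟩ := h.mem_graph.1 huw
    rw [inner_apply_comm_of_nonneg h.nonneg_right, inner_apply_comm_of_nonneg h.nonneg_left,
      h.apply_comm, sub_self]

theorem ratioOp_nonneg (h : IsBoundedTransform a b) (u : (ratioOp a b).domain) :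
    0 ≤ (⟪(u : H), ratioOp a b u⟫_ℂ).re := by
  obtain ⟨v, hav, hbv⟩ := h.mem_graph.1 ((ratioOp a b).mem_graph u)
  rw [← hav, ← hbv, inner_apply_comm_of_nonneg h.nonneg_left]
  exact ((ContinuousLinearMap.nonneg_iff_isPositive _).1
    (h.commute.mul_nonneg h.nonneg_left h.nonneg_right)).re_inner_nonneg_right v

theorem isGraphSqrt (h : IsBoundedTransform a b) {G : Submodule ℂ (H × H)}
    (hG : ∀ u w, (u, w) ∈ G ↔ a (a (u + w)) = u) : IsGraphSqrt (ratioOp a b) G :=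
  ⟨h.dense_domain, h.isSelfAdjoint, h.ratioOp_nonneg,
    fun u w => (hG u w).trans h.exists_mem_graph_iff.symm⟩

end IsBoundedTransform

namespace IsGraphSqrt

variable [CompleteSpace H] {S : H →ₗ.[ℂ] H} {G : Submodule ℂ (H × H)}

theorem re_inner_nonneg (h : IsGraphSqrt S G) {u v : H} (huv : (u, v) ∈ S.graph) :
    0 ≤ (⟪u, v⟫_ℂ).re := by
  obtain ⟨y, rfl, rfl⟩ := (LinearPMap.mem_graph_iff S).1 huv
  exact h.nonneg y

theorem inner_comm (h : IsGraphSqrt S G) {u v x y : H} (huv : (u, v) ∈ S.graph)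
    (hxy : (x, y) ∈ S.graph) : ⟪y, u⟫_ℂ = ⟪x, v⟫_ℂ := by
  rw [← (isSelfAdjoint_iff_adjoint_graph_eq h.dense_domain).1 h.isSelfAdjoint] at huv
  exact sub_eq_zero.1 ((Submodule.mem_adjoint_iff _ _).1 huv x y hxy)

/-- Here `R = (1 + S²)⁻¹` and `C = S (1 + S²)⁻¹`. -/
theorem exists_linearMap_mem_graph (h : IsGraphSqrt S G) {R : H →L[ℂ] H}
    (hR : ∀ z, (R z, z - R z) ∈ G) :
    ∃ C : H →ₗ[ℂ] H, ∀ z, (R z, C z) ∈ S.graph ∧ (C z, z - R z) ∈ S.graph := by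
  choose c hRc hcR using fun z => (h.mem_iff _ _).1 (hR z)
  exact ⟨{  toFun := c
            map_add' := fun y z =>
              S.mem_graph_snd_inj (hRc (y + z)) (S.graph.add_mem (hRc y) (hRc z)) (by simp)
            map_smul' := fun t z =>
              S.mem_graph_snd_inj (hRc (t • z)) (S.graph.smul_mem t (hRc z)) (by simp) },
    fun z => ⟨hRc z, hcR z⟩⟩

theorem exists_nonneg_mul_self_eq (h : IsGraphSqrt S G) {R : H →L[ℂ] H} (hR₀ : 0 ≤ R)
    (hR : ∀ z, (R z, z - R z) ∈ G) :
    ∃ C : H →L[ℂ] H, 0 ≤ C ∧ C * C = R * (1 - R) ∧ ∀ z, (R z, C z) ∈ S.graph := by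
  obtain ⟨C, hC⟩ := h.exists_linearMap_mem_graph hR
  have inner_split : ∀ x z, ⟪x, z⟫_ℂ = ⟪x, R z⟫_ℂ + ⟪x, z - R z⟫_ℂ := fun x z => by
    rw [← inner_add_right, add_sub_cancel]
  have hsymm : C.IsSymmetric := fun y z => by
    rw [inner_split (C y) z, ← inner_conj_symm y, inner_split (C z) y, map_add, inner_conj_symm,
      inner_conj_symm, h.inner_comm (hC z).1 (hC y).1, ← h.inner_comm (hC z).2 (hC y).2, add_comm]
  refine ⟨⟨C, hsymm.continuous⟩, ?_, ?_, fun z => (hC z).1⟩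
  · rw [ContinuousLinearMap.nonneg_iff_isPositive]
    refine ⟨hsymm, fun z => ?_⟩
    change 0 ≤ (⟪C z, z⟫_ℂ).re
    rw [inner_split, add_re, h.inner_comm (hC z).1 (hC z).1]
    exact add_nonneg (h.re_inner_nonneg (hC z).1) (h.re_inner_nonneg (hC z).2)
  · ext z
    refine ext_inner_left ℂ fun x => ?_
    change ⟪x, C (C z)⟫_ℂ = ⟪x, R (z - R z)⟫_ℂ
    rw [← hsymm, h.inner_comm (hC z).2 (hC x).1, inner_apply_comm_of_nonneg hR₀]

theorem eq_ratioOp (h : IsGraphSqrt S G) {a b : H →L[ℂ] H} (hab : IsBoundedTransform a b)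
    (hG : ∀ u w, (u, w) ∈ G ↔ a (a (u + w)) = u) : S = ratioOp a b := by
  have hbb : 1 - a * a = b * b := sub_eq_of_eq_add' hab.mul_self_add.symm
  obtain ⟨C, hC₀, hCC, hC⟩ := h.exists_nonneg_mul_self_eq (R := a * a)
    (Commute.mul_nonneg hab.nonneg_left hab.nonneg_left (Commute.refl a))
    fun z => (hG _ _).2 (by rw [add_sub_cancel]; rfl)
  have hCab : C = a * b := by
    refine (CFC.mul_self_eq_mul_self_iff C (a * b) hC₀
      (hab.commute.mul_nonneg hab.nonneg_left hab.nonneg_right)).1 ?_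
    rw [hCC, hbb, hab.commute.symm.mul_mul_mul_comm]
  have hclosed : IsClosed {v : H | (a v, b v) ∈ S.graph} :=
    IsClosed.preimage (a.continuous.prodMk b.continuous) h.isSelfAdjoint.isClosed
  have hgraph : ∀ v, (a v, b v) ∈ S.graph := fun v => by
    refine (denseRange_of_nonneg_of_injective hab.nonneg_left hab.injective).induction_on
      (p := fun v => (a v, b v) ∈ S.graph) v hclosed fun z => ?_
    rw [← hab.apply_comm]
    simpa only [hCab] using! hC z
  have hle : (ratioOp a b).graph ≤ S.graph := by
    rintro ⟨x, y⟩ hxy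
    obtain ⟨v, rfl, rfl⟩ := hab.mem_graph.1 hxy
    exact hgraph v
  refine LinearPMap.eq_of_eq_graph (le_antisymm ?_ hle)
  rw [← (isSelfAdjoint_iff_adjoint_graph_eq h.dense_domain).1 h.isSelfAdjoint,
    ← (isSelfAdjoint_iff_adjoint_graph_eq hab.dense_domain).1 hab.isSelfAdjoint]
  intro x hx
  rw [Submodule.mem_adjoint_iff] at hx ⊢
  exact fun u v huv => hx u v (hle huv)

theorem congr_isometryEquiv {K : Type*} [NormedAddCommGroup K] [InnerProductSpace ℂ K]
    [CompleteSpace K] (h : IsGraphSqrt S G) (U : H ≃ₗᵢ[ℂ] K) {T : K →ₗ.[ℂ] K}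
    {F : Submodule ℂ (K × K)} (hT : ∀ u v, (U u, U v) ∈ T.graph ↔ (u, v) ∈ S.graph)
    (hF : ∀ u w, (U u, U w) ∈ F ↔ (u, w) ∈ G) : IsGraphSqrt T F := by
  have hdense : Dense (T.domain : Set K) := by
    refine (U.surjective.denseRange.dense_image U.continuous h.dense_domain).mono ?_
    rintro _ ⟨u, hu, rfl⟩
    exact LinearPMap.mem_domain_of_mem_graph ((hT u (S ⟨u, hu⟩)).2 (S.mem_graph ⟨u, hu⟩))
  refine ⟨hdense, ?_, fun x => ?_, ?_⟩
  · rw [isSelfAdjoint_iff_adjoint_graph_eq hdense]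
    ext ⟨x, y⟩
    obtain ⟨u, rfl⟩ := U.surjective x
    obtain ⟨v, rfl⟩ := U.surjective y
    rw [hT, ← (isSelfAdjoint_iff_adjoint_graph_eq h.dense_domain).1 h.isSelfAdjoint]
    simp only [Submodule.mem_adjoint_iff, U.surjective.forall, hT, U.inner_map_map]
  · obtain ⟨u, hu⟩ := U.surjective x
    obtain ⟨v, hv⟩ := U.surjective (T x)
    rw [← hu, ← hv, U.inner_map_map]
    exact h.re_inner_nonneg ((hT u v).1 (by rw [hu, hv]; exact T.mem_graph x))
  · simp only [U.surjective.forall, U.surjective.exists, hT, hF]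
    exact h.mem_iff

end IsGraphSqrt

theorem isBoundedTransform_sqrt [CompleteSpace H] {R : H →L[ℂ] H} (hR₀ : 0 ≤ R) (hR₁ : R ≤ 1)
    (hinj : Function.Injective R) : IsBoundedTransform (CFC.sqrt R) (CFC.sqrt (1 - R)) where
  nonneg_left := CFC.sqrt_nonneg R
  nonneg_right := CFC.sqrt_nonneg _
  commute := by
    have h : Commute R (CFC.sqrt (1 - R)) := by
      rw [CFC.sqrt_eq_cfc (a := 1 - R)]
      exact (((Commute.one_left R).sub_left (Commute.refl R)).cfc_nnreal _).symm
    rw [CFC.sqrt_eq_cfc (a := R)]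
    exact h.cfc_nnreal _
  mul_self_add := by
    rw [CFC.sqrt_mul_sqrt_self R hR₀, CFC.sqrt_mul_sqrt_self _ (sub_nonneg.2 hR₁), add_sub_cancel]
  injective := by
    refine Function.Injective.of_comp (f := (CFC.sqrt R : H →L[ℂ] H)) ?_
    change Function.Injective ⇑(CFC.sqrt R * CFC.sqrt R)
    rwa [CFC.sqrt_mul_sqrt_self R hR₀]

theorem existsUnique_isGraphSqrt_of_resolvent [CompleteSpace H] {R : H →L[ℂ] H} (hR₀ : 0 ≤ R)
    (hR₁ : R ≤ 1) (hinj : Function.Injective R) {G : Submodule ℂ (H × H)}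
    (hG : ∀ u w, (u, w) ∈ G ↔ R (u + w) = u) : ∃! S : H →ₗ.[ℂ] H, IsGraphSqrt S G := by
  have hab := isBoundedTransform_sqrt hR₀ hR₁ hinj
  have hG' : ∀ u w, (u, w) ∈ G ↔ CFC.sqrt R (CFC.sqrt R (u + w)) = u := fun u w => by
    rw [hG, ← mul_apply_eq_comp, CFC.sqrt_mul_sqrt_self R hR₀]
  exact ⟨_, hab.isGraphSqrt hG', fun S hS => hS.eq_ratioOp hab hG'⟩

end SquareRoot

/-! ### Von Neumann's theorem on the operators `T*T` -/

section VonNeumann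

variable {H H' : Type*} [NormedAddCommGroup H] [InnerProductSpace ℂ H]
  [NormedAddCommGroup H'] [InnerProductSpace ℂ H']

/-- A linear relation, regarded as a subspace of the Hilbert sum `H ⊕ H'`. -/
def hilbertGraph (Γ : Submodule ℂ (H × H')) : Submodule ℂ (WithLp 2 (H × H')) :=
  Γ.comap (WithLp.linearEquiv 2 ℂ (H × H')).toLinearMap

theorem mem_hilbertGraph {Γ : Submodule ℂ (H × H')} {x : WithLp 2 (H × H')} :
    x ∈ hilbertGraph Γ ↔ (x.fst, x.snd) ∈ Γ :=
  Iff.rfl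

variable [CompleteSpace H] [CompleteSpace H']

theorem hasOrthogonalProjection_hilbertGraph {Γ : Submodule ℂ (H × H')}
    (hΓ : IsClosed (Γ : Set (H × H'))) : (hilbertGraph Γ).HasOrthogonalProjection := by
  have hclosed : IsClosed (hilbertGraph Γ : Set (WithLp 2 (H × H'))) :=
    hΓ.preimage (WithLp.prodContinuousLinearEquiv 2 ℂ H H').continuous
  have := hclosed.completeSpace_coe
  infer_instance

variable (Γ : Submodule ℂ (H × H')) [(hilbertGraph Γ).HasOrthogonalProjection]

/-- The resolvent `(1 + T*T)⁻¹` of an operator `T` with graph `Γ`: it maps `z` to the first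
component of the orthogonal projection of `(z, 0)` onto `Γ`. -/
def graphResolvent : H →L[ℂ] H :=
  WithLp.fstL 2 ℂ H H' ∘L (hilbertGraph Γ).starProjection ∘L
    ContinuousLinearMap.adjoint (WithLp.fstL 2 ℂ H H')

omit [(hilbertGraph Γ).HasOrthogonalProjection] in
theorem adjoint_fstL_apply (z : H) :
    ContinuousLinearMap.adjoint (WithLp.fstL 2 ℂ H H') z = WithLp.toLp 2 (z, 0) := by
  refine ext_inner_left ℂ fun x => ?_
  rw [ContinuousLinearMap.adjoint_inner_right, WithLp.prod_inner_apply]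
  simp

theorem graphResolvent_apply (z : H) : graphResolvent Γ z =
    ((hilbertGraph Γ).starProjection (WithLp.toLp 2 (z, 0))).fst := by
  rw [← adjoint_fstL_apply]
  rfl

theorem graphResolvent_nonneg : 0 ≤ graphResolvent Γ := by
  rw [ContinuousLinearMap.nonneg_iff_isPositive]
  refine ContinuousLinearMap.IsPositive.conj_adjoint ?_ _
  rw [← ContinuousLinearMap.nonneg_iff_isPositive]
  exact isStarProjection_starProjection.nonneg

theorem graphResolvent_le_one : graphResolvent Γ ≤ 1 := by
  set π := WithLp.fstL 2 ℂ H H'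
  have hπ : π ∘L ContinuousLinearMap.adjoint π = 1 := by
    ext z
    simp [π, adjoint_fstL_apply]
  have hsub : 1 - graphResolvent Γ =
      π ∘L (1 - (hilbertGraph Γ).starProjection) ∘L ContinuousLinearMap.adjoint π := by
    rw [ContinuousLinearMap.sub_comp, ContinuousLinearMap.comp_sub, graphResolvent, ← hπ]
    rfl
  rw [← sub_nonneg, hsub, ContinuousLinearMap.nonneg_iff_isPositive]
  refine ContinuousLinearMap.IsPositive.conj_adjoint ?_ _
  rw [← ContinuousLinearMap.nonneg_iff_isPositive]
  exact isStarProjection_starProjection.one_sub_nonneg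

theorem graphResolvent_eq_iff {z u : H} :
    graphResolvent Γ z = u ↔ ∃ v, (u, v) ∈ Γ ∧ (v, z - u) ∈ Γ.adjoint := by
  rw [graphResolvent_apply]
  have horth : ∀ a b v, ⟪WithLp.toLp 2 (z, (0 : H')) - WithLp.toLp 2 (u, v),
      (WithLp.toLp 2 (a, b) : WithLp 2 (H × H'))⟫_ℂ = 0 ↔ ⟪b, v⟫_ℂ - ⟪a, z - u⟫_ℂ = 0 :=
    fun a b v => by
      have hinner : ⟪(WithLp.toLp 2 (a, b) : WithLp 2 (H × H')),
          WithLp.toLp 2 (z, (0 : H')) - WithLp.toLp 2 (u, v)⟫_ℂ = ⟪a, z - u⟫_ℂ - ⟪b, v⟫_ℂ := by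
        rw [WithLp.prod_inner_apply]
        simp [inner_sub_right, ← sub_eq_add_neg]
      rw [← inner_conj_symm, map_eq_zero, hinner, ← neg_eq_zero, neg_sub]
  constructor
  · rintro rfl
    refine ⟨((hilbertGraph Γ).starProjection (WithLp.toLp 2 (z, 0))).snd,
      mem_hilbertGraph.1 (Submodule.starProjection_apply_mem _ _), ?_⟩
    rw [Submodule.mem_adjoint_iff]
    intro a b hab
    exact (horth a b _).1 ((hilbertGraph Γ).starProjection_inner_eq_zero _ _
      (mem_hilbertGraph.2 hab))
  · rintro ⟨v, huv, hv⟩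
    rw [Submodule.mem_adjoint_iff] at hv
    rw [(hilbertGraph Γ).eq_starProjection_of_mem_of_inner_eq_zero (v := WithLp.toLp 2 (u, v))
      (mem_hilbertGraph.2 huv) fun x hx => (horth x.fst x.snd v).2 (hv _ _ hx)]
    rfl

theorem graphResolvent_injective (hΓ : Dense {u | ∃ v, (u, v) ∈ Γ}) :
    Function.Injective (graphResolvent Γ) := by
  rw [injective_iff_map_eq_zero]
  intro z hz
  obtain ⟨v, hv, hadj⟩ := (graphResolvent_eq_iff Γ).1 hz
  rw [Submodule.mem_adjoint_iff] at hadj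
  obtain rfl : v = 0 := by simpa using hadj 0 v hv
  refine hΓ.eq_zero_of_inner_right ℂ ?_
  rintro u ⟨w, huw⟩
  simpa using hadj u w huw

/-- Here `Γ` is the graph of a closed operator `T`, and `G` is the graph of `T*T`. -/
theorem existsUnique_isGraphSqrt {Γ : Submodule ℂ (H × H')} (hclosed : IsClosed (Γ : Set (H × H')))
    (hdense : Dense {u | ∃ v, (u, v) ∈ Γ}) {G : Submodule ℂ (H × H)}
    (hG : ∀ u w, (u, w) ∈ G ↔ ∃ v, (u, v) ∈ Γ ∧ (v, w) ∈ Γ.adjoint) :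
    ∃! S : H →ₗ.[ℂ] H, IsGraphSqrt S G := by
  have := hasOrthogonalProjection_hilbertGraph hclosed
  refine existsUnique_isGraphSqrt_of_resolvent (graphResolvent_nonneg Γ) (graphResolvent_le_one Γ)
    (graphResolvent_injective Γ hdense) fun u w => ?_
  rw [hG, graphResolvent_eq_iff, add_sub_cancel_left]

end VonNeumann

/-! ### The magnetic Schrödinger operator -/

section Magnetic

variable {d : ℕ}

theorem IsTest.fderiv_apply {ψ : E d → ℂ} (h : IsTest ψ) (v : E d) :
    IsTest fun x => fderiv ℝ ψ x v :=
  ⟨(h.1.fderiv_right (m := ∞) (by simp)).clm_apply contDiff_const, h.2.fderiv_apply ℝ v⟩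

theorem IsTest.mul_left {ψ g : E d → ℂ} (h : IsTest ψ) (hg : ContDiff ℝ ∞ g) :
    IsTest fun x => g x * ψ x :=
  ⟨hg.mul h.1, h.2.mul_left⟩

theorem IsTest.memLp {ψ : E d → ℂ} (h : IsTest ψ) : MemLp ψ 2 (volume : Measure (E d)) :=
  h.1.continuous.memLp_of_hasCompactSupport h.2

theorem IsTest.integrable_mul {f ψ : E d → ℂ} (hf : IsTest f) (hψ : IsTest ψ) :
    Integrable fun x => f x * ψ x :=
  hf.memLp.integrable_mul hψ.memLp

theorem IsL2Loc.memLp_mul_test {A : E d → E d} (hA : IsL2Loc A) (j : Fin d) {ψ : E d → ℂ}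
    (hψ : IsTest ψ) : MemLp (fun x => ((A x j : ℝ) : ℂ) * ψ x) 2 (volume : Measure (E d)) := by
  have hAj : MemLp (fun x => ((A x j : ℝ) : ℂ)) 2 (volume.restrict (tsupport ψ)) :=
    ((EuclideanSpace.proj (𝕜 := ℝ) j).comp_memLp' (hA _ hψ.2)).ofReal
  obtain ⟨C, hC⟩ := hψ.2.exists_bound_of_continuous hψ.1.continuous
  have hAψ : MemLp (fun x => ((A x j : ℝ) : ℂ) * ψ x) 2 (volume.restrict (tsupport ψ)) :=
    hAj.of_le_mul (c := C) (hAj.1.mul hψ.1.continuous.aestronglyMeasurable)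
      (Eventually.of_forall fun x => by rw [norm_mul, mul_comm]; gcongr; exact hC x)
  rw [← memLp_indicator_iff_restrict (isClosed_tsupport ψ).measurableSet] at hAψ
  refine (memLp_congr_ae (ae_of_all _ fun x => ?_)).1 hAψ
  refine Set.indicator_apply_eq_self.2 fun hx => ?_
  rw [image_eq_zero_of_notMem_tsupport hx, mul_zero]

theorem IsL2Loc.memLp_magTest {A : E d → E d} (hA : IsL2Loc A) (j : Fin d) {ψ : E d → ℂ}
    (hψ : IsTest ψ) : MemLp (fun x => I * fderiv ℝ ψ x (EuclideanSpace.single j 1) -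
      ((A x j : ℝ) : ℂ) * ψ x) 2 (volume : Measure (E d)) :=
  ((hψ.fderiv_apply _).memLp.const_mul I).sub (hA.memLp_mul_test j hψ)

theorem integral_mul_eq_inner {g : E d → ℂ} (hg : MemLp g 2 (volume : Measure (E d)))
    (u : L2 d) : ∫ x, u x * g x = ⟪hg.star.toLp, u⟫_ℂ := by
  rw [L2.inner_def]
  refine integral_congr_ae ?_
  filter_upwards [hg.star.coeFn_toLp] with x hx
  rw [hx]
  simp [mul_comm]

theorem isMagDeriv_iff_inner_eq {A : E d → E d} (hA : IsL2Loc A) (j : Fin d) (u v : L2 d) :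
    IsMagDeriv A j u v ↔ ∀ (ψ : E d → ℂ) (hψ : IsTest ψ),
      ⟪(hA.memLp_magTest j hψ).star.toLp, u⟫_ℂ = ⟪hψ.memLp.star.toLp, v⟫_ℂ := by
  refine forall₂_congr fun ψ hψ => ?_
  rw [← integral_mul_eq_inner (hA.memLp_magTest j hψ), ← integral_mul_eq_inner hψ.memLp]
  exact and_iff_right ((Lp.memLp u).integrable_mul (hA.memLp_magTest j hψ))

theorem integral_mul_fderiv_test {f ψ : E d → ℂ} (hf : IsTest f) (hψ : IsTest ψ) (v : E d) :
    ∫ x, f x * fderiv ℝ ψ x v = -∫ x, fderiv ℝ f x v * ψ x :=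
  integral_mul_fderiv_eq_neg_fderiv_mul_of_integrable
    ((hf.fderiv_apply v).integrable_mul hψ) (hf.integrable_mul (hψ.fderiv_apply v))
    (hf.integrable_mul hψ)
    (fun x _ => hf.1.differentiable (by simp) x) (fun x _ => hψ.1.differentiable (by simp) x)

theorem IsTest.exists_isMagDeriv {A : E d → E d} (hA : IsL2Loc A) (j : Fin d) {f : E d → ℂ}
    (hf : IsTest f) : ∃ v : L2 d, IsMagDeriv A j hf.memLp.toLp v := by
  set e : E d := EuclideanSpace.single j 1
  have hv : MemLp (fun x => (-I) * fderiv ℝ f x e - ((A x j : ℝ) : ℂ) * f x) 2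
      (volume : Measure (E d)) :=
    ((hf.fderiv_apply _).memLp.const_mul (-I)).sub (hA.memLp_mul_test j hf)
  refine ⟨hv.toLp, fun ψ hψ => ⟨(Lp.memLp _).integrable_mul (hA.memLp_magTest j hψ), ?_⟩⟩
  have hpot : Integrable fun x => f x * (((A x j : ℝ) : ℂ) * ψ x) :=
    hf.memLp.integrable_mul (hA.memLp_mul_test j hψ)
  have hparts := integral_mul_fderiv_test hf hψ e
  calc ∫ x, (hf.memLp.toLp : L2 d) x * (I * fderiv ℝ ψ x e - ((A x j : ℝ) : ℂ) * ψ x)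
      = ∫ x, I * (f x * fderiv ℝ ψ x e) - f x * (((A x j : ℝ) : ℂ) * ψ x) := by
        refine integral_congr_ae ?_
        filter_upwards [hf.memLp.coeFn_toLp] with x hx
        rw [hx]
        ring
    _ = ∫ x, (-I) * (fderiv ℝ f x e * ψ x) - f x * (((A x j : ℝ) : ℂ) * ψ x) := by
        rw [integral_sub ((hf.integrable_mul (hψ.fderiv_apply e)).const_mul I) hpot,
          integral_sub (((hf.fderiv_apply e).integrable_mul hψ).const_mul (-I)) hpot,
          integral_const_mul, integral_const_mul, hparts, mul_neg, neg_mul]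
    _ = ∫ x, (hv.toLp : L2 d) x * ψ x := by
        refine integral_congr_ae ?_
        filter_upwards [hv.coeFn_toLp] with x hx
        rw [hx]
        ring

theorem eq_zero_of_inner_test_eq_zero {z : L2 d}
    (h : ∀ (f : E d → ℂ) (hf : IsTest f), ⟪hf.memLp.toLp, z⟫_ℂ = 0) : z = 0 := by
  rw [Lp.eq_zero_iff_ae_eq_zero]
  refine ae_eq_zero_of_integral_contDiff_smul_eq_zero
    ((Lp.memLp z).locallyIntegrable (by norm_num)) fun g hg hg' => ?_
  have ht : IsTest fun x => ((g x : ℝ) : ℂ) :=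
    ⟨ofRealCLM.contDiff.comp hg, hg'.comp_left (g := fun t : ℝ => (t : ℂ)) ofReal_zero⟩
  rw [← h _ ht, L2.inner_def]
  refine integral_congr_ae ?_
  filter_upwards [ht.memLp.coeFn_toLp] with x hx
  rw [hx]
  simp [mul_comm]

/-- The graph of the operator `u ↦ (m u, (-i∇ - A) u)`, the mass term having the index `none`;
if `T` denotes this operator, then `(-i∇ - A)² + m² = T*T`. -/
def magGradient (m : ℝ) (A : E d → E d) :
    Submodule ℂ (L2 d × PiLp 2 fun _ : Option (Fin d) => L2 d) where
  carrier := {z | z.2 none = (m : ℂ) • z.1 ∧ ∀ j, IsMagDeriv A j z.1 (z.2 (some j))}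
  zero_mem' := ⟨by simp, IsMagDeriv.zero A⟩
  add_mem' := fun {z z'} hz hz' =>
    ⟨by simp [hz.1, hz'.1], fun j => (hz.2 j).add (hz'.2 j)⟩
  smul_mem' := fun c z hz => ⟨by
    rw [Prod.smul_snd, PiLp.smul_apply, hz.1, smul_comm]
    rfl, fun j => (hz.2 j).smul c⟩

theorem mem_magGradient {m : ℝ} {A : E d → E d} {u : L2 d}
    {p : PiLp 2 fun _ : Option (Fin d) => L2 d} :
    (u, p) ∈ magGradient m A ↔ p none = (m : ℂ) • u ∧ ∀ j, IsMagDeriv A j u (p (some j)) :=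
  Iff.rfl

theorem isClosed_magGradient (m : ℝ) {A : E d → E d} (hA : IsL2Loc A) :
    IsClosed (magGradient m A : Set (L2 d × PiLp 2 fun _ : Option (Fin d) => L2 d)) := by
  have hset : (magGradient m A : Set (L2 d × PiLp 2 fun _ : Option (Fin d) => L2 d)) =
      {z | z.2 none = (m : ℂ) • z.1} ∩ ⋂ (j : Fin d) (ψ : E d → ℂ) (hψ : IsTest ψ),
        {z | ⟪(hA.memLp_magTest j hψ).star.toLp, z.1⟫_ℂ =
          ⟪hψ.memLp.star.toLp, z.2 (some j)⟫_ℂ} := by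
    ext z
    simp only [Set.mem_inter_iff, Set.mem_iInter, Set.mem_ofPred_eq]
    exact and_congr_right fun _ => forall_congr' fun j => isMagDeriv_iff_inner_eq hA j _ _
  rw [hset]
  refine (isClosed_eq ?_ ?_).inter (isClosed_iInter fun j => isClosed_iInter fun ψ =>
    isClosed_iInter fun hψ => isClosed_eq ?_ ?_) <;> fun_prop

theorem dense_domain_magGradient (m : ℝ) {A : E d → E d} (hA : IsL2Loc A) :
    Dense {u | ∃ p, (u, p) ∈ magGradient m A} := by
  let D : Submodule ℂ (L2 d) := (magGradient m A).map (LinearMap.fst ℂ _ _)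
  have hD : (D : Set (L2 d)) = {u | ∃ p, (u, p) ∈ magGradient m A} := by
    ext u
    simp [D]
  rw [← hD, Submodule.dense_iff_topologicalClosure_eq_top,
    Submodule.topologicalClosure_eq_top_iff, Submodule.eq_bot_iff]
  intro z hz
  refine eq_zero_of_inner_test_eq_zero fun f hf => (Submodule.mem_orthogonal _ _).1 hz _ ?_
  choose p hp using fun j => hf.exists_isMagDeriv hA j
  rw [← SetLike.mem_coe, hD]
  exact ⟨WithLp.toLp 2 fun o => o.elim ((m : ℂ) • hf.memLp.toLp) p, rfl, hp⟩

theorem mem_magGraph_iff (m : ℝ) (A : E d → E d) (u w : L2 d) :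
    (u, w) ∈ magGraph m A ↔
      ∃ p, (u, p) ∈ magGradient m A ∧ (p, w) ∈ (magGradient m A).adjoint := by
  have hinner : ∀ {v u q p}, (v, q) ∈ magGradient m A → (u, p) ∈ magGradient m A →
      ⟪q, p⟫_ℂ = ∑ j, ⟪q (some j), p (some j)⟫_ℂ + ((m ^ 2 : ℝ) : ℂ) * ⟪v, u⟫_ℂ := by
    intro v u q p hq hp
    rw [PiLp.inner_apply, Fintype.sum_option, (mem_magGradient.1 hq).1, (mem_magGradient.1 hp).1,
      inner_smul_left, inner_smul_right, conj_ofReal]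
    push_cast
    ring
  have hmem : ∀ {u p}, (∀ j, IsMagDeriv A j u (p j)) →
      (u, WithLp.toLp 2 fun o => o.elim ((m : ℂ) • u) p) ∈ magGradient m A := fun hp => ⟨rfl, hp⟩
  constructor
  · rintro ⟨p, hp, h⟩
    refine ⟨_, hmem hp, (Submodule.mem_adjoint_iff _ _).2 fun v q hq => sub_eq_zero.2 ?_⟩
    exact (hinner hq (hmem hp)).trans (h v _ (mem_magGradient.1 hq).2)
  · rintro ⟨p, hp, hadj⟩
    refine ⟨fun j => p (some j), (mem_magGradient.1 hp).2, fun v q hq => ?_⟩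
    exact (hinner (hmem hq) hp).symm.trans
      (sub_eq_zero.1 ((Submodule.mem_adjoint_iff _ _).1 hadj v _ (hmem hq)))

theorem isNonnegSqrt_iff_isGraphSqrt {S : L2 d →ₗ.[ℂ] L2 d} {G : Submodule ℂ (L2 d × L2 d)} :
    IsNonnegSqrt S G ↔ IsGraphSqrt S G :=
  ⟨fun h => ⟨h.1, h.2.1, h.2.2.1, h.2.2.2⟩,
    fun h => ⟨h.dense_domain, h.isSelfAdjoint, h.nonneg, h.mem_iff⟩⟩

theorem existsUnique_isNonnegSqrt (m : ℝ) {A : E d → E d} (hA : IsL2Loc A) :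
    ∃! S : L2 d →ₗ.[ℂ] L2 d, IsNonnegSqrt S (magGraph m A) := by
  simp only [isNonnegSqrt_iff_isGraphSqrt]
  exact existsUnique_isGraphSqrt (isClosed_magGradient m hA) (dense_domain_magGradient m hA)
    (mem_magGraph_iff m A)

end Magnetic

/-! ### Gauge covariance of the square root -/

section Phase

variable {d : ℕ}

theorem coeFn_phaseOp (φ : 𝓢(E d, ℝ)) (u : L2 d) : phaseOp φ u =ᵐ[volume] mulPhase φ u :=
  (memLp_mulPhase φ u).coeFn_toLp

theorem phaseOp_neg_phaseOp (φ : 𝓢(E d, ℝ)) (u : L2 d) : phaseOp (-φ) (phaseOp φ u) = u := by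
  apply Lp.ext
  filter_upwards [coeFn_phaseOp (-φ) (phaseOp φ u), coeFn_phaseOp φ u] with x h h'
  rw [h, mulPhase, h', mulPhase, ← mul_assoc, ← Complex.exp_add]
  simp

theorem phaseOp_phaseOp_neg (φ : 𝓢(E d, ℝ)) (u : L2 d) : phaseOp φ (phaseOp (-φ) u) = u := by
  simpa using phaseOp_neg_phaseOp (-φ) u

theorem inner_phaseOp_phaseOp (φ : 𝓢(E d, ℝ)) (u v : L2 d) :
    ⟪phaseOp φ u, phaseOp φ v⟫_ℂ = ⟪u, v⟫_ℂ := by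
  rw [L2.inner_def, L2.inner_def]
  refine integral_congr_ae ?_
  filter_upwards [coeFn_phaseOp φ u, coeFn_phaseOp φ v] with x hu hv
  have hphase : cexp (I * ((φ x : ℝ) : ℂ)) * starRingEnd ℂ (cexp (I * ((φ x : ℝ) : ℂ))) = 1 := by
    rw [← Complex.exp_conj, ← Complex.exp_add]
    simp
  rw [hu, hv, mulPhase, mulPhase, RCLike.inner_apply, RCLike.inner_apply, map_mul]
  linear_combination (v x * starRingEnd ℂ (u x)) * hphase

/-- `phaseOp φ` as a unitary operator. -/
def phaseEquiv (φ : 𝓢(E d, ℝ)) : L2 d ≃ₗᵢ[ℂ] L2 d :=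
  LinearEquiv.isometryOfInner (LinearEquiv.ofLinearMap (phaseOp φ) (phaseOp (-φ))
    (LinearMap.ext (phaseOp_phaseOp_neg φ)) (LinearMap.ext (phaseOp_neg_phaseOp φ)))
    (inner_phaseOp_phaseOp φ)

theorem inner_phaseOp_left (φ : 𝓢(E d, ℝ)) (u v : L2 d) :
    ⟪phaseOp φ u, v⟫_ℂ = ⟪u, phaseOp (-φ) v⟫_ℂ := by
  rw [← inner_phaseOp_phaseOp φ u, phaseOp_phaseOp_neg]

theorem mem_gaugeConj_graph (φ : 𝓢(E d, ℝ)) (S : L2 d →ₗ.[ℂ] L2 d) (u v : L2 d) :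
    (phaseOp φ u, phaseOp φ v) ∈ (gaugeConj φ S).graph ↔ (u, v) ∈ S.graph := by
  have hdom : phaseOp φ u ∈ (gaugeConj φ S).domain ↔ u ∈ S.domain := by
    change phaseOp (-φ) (phaseOp φ u) ∈ S.domain ↔ _
    rw [phaseOp_neg_phaseOp]
  have happly : ∀ (hu : u ∈ S.domain),
      gaugeConj φ S ⟨phaseOp φ u, hdom.2 hu⟩ = phaseOp φ (S ⟨u, hu⟩) := fun hu => by
    refine congrArg (fun x => phaseOp φ (S x)) (Subtype.ext ?_)
    exact phaseOp_neg_phaseOp φ u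
  simp only [LinearPMap.mem_graph_iff, Subtype.exists, exists_and_left, exists_eq_left]
  constructor
  · rintro ⟨hu, h⟩
    exact ⟨hdom.1 hu, (phaseEquiv φ).injective ((happly _).symm.trans h)⟩
  · rintro ⟨hu, rfl⟩
    exact ⟨hdom.2 hu, happly hu⟩

theorem gradient_apply (φ : 𝓢(E d, ℝ)) (x : E d) (j : Fin d) :
    gradient (fun z => φ z) x j = fderiv ℝ φ x (EuclideanSpace.single j 1) := by
  rw [← InnerProductSpace.toDual_symm_apply, EuclideanSpace.inner_single_right]
  simp [gradient]

theorem contDiff_gradient (φ : 𝓢(E d, ℝ)) :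
    ContDiff ℝ ∞ fun x => gradient (fun z => φ z) x :=
  (InnerProductSpace.toDual ℝ (E d)).symm.contDiff.comp
    ((φ.smooth ⊤).fderiv_right (m := ∞) (by simp))

theorem gauge_gauge_neg (A : E d → E d) (φ : 𝓢(E d, ℝ)) : gauge (gauge A φ) (-φ) = A := by
  ext x j
  simp only [gauge, PiLp.add_apply, gradient_apply]
  rw [show ⇑(-φ) = -⇑φ from rfl, fderiv_neg]
  simp

theorem IsL2Loc.gauge {A : E d → E d} (hA : IsL2Loc A) (φ : 𝓢(E d, ℝ)) :
    IsL2Loc (MagRel.gauge A φ) := fun K hK => by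
  have hcont := (contDiff_gradient φ).continuous
  obtain ⟨C, hC⟩ := hK.exists_bound_of_continuousOn hcont.continuousOn
  have : IsFiniteMeasure ((volume : Measure (E d)).restrict K) :=
    isFiniteMeasure_restrict.2 hK.measure_ne_top
  exact (hA K hK).add (MemLp.of_bound hcont.aestronglyMeasurable C
    ((ae_restrict_iff' hK.measurableSet).2 (ae_of_all _ hC)))

theorem contDiff_phase (φ : 𝓢(E d, ℝ)) :
    ContDiff ℝ ∞ fun x : E d => cexp (I * ((φ x : ℝ) : ℂ)) :=
  (contDiff_const.mul (ofRealCLM.contDiff.comp (φ.smooth ⊤))).cexp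

theorem IsTest.mulPhase {ψ : E d → ℂ} (hψ : IsTest ψ) (φ : 𝓢(E d, ℝ)) :
    IsTest (MagRel.mulPhase φ ψ) :=
  hψ.mul_left (contDiff_phase φ)

theorem fderiv_mulPhase (φ : 𝓢(E d, ℝ)) {ψ : E d → ℂ} {x : E d} (hψ : DifferentiableAt ℝ ψ x)
    (v : E d) : fderiv ℝ (mulPhase φ ψ) x v =
      cexp (I * ((φ x : ℝ) : ℂ)) * (fderiv ℝ ψ x v + I * ((fderiv ℝ φ x v : ℝ) : ℂ) * ψ x) := by
  have hφ : HasFDerivAt (fun x : E d => ((φ x : ℝ) : ℂ)) (ofRealCLM ∘L fderiv ℝ φ x) x :=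
    ofRealCLM.hasFDerivAt.comp x φ.differentiableAt.hasFDerivAt
  have hmul : HasFDerivAt (mulPhase φ ψ) _ x := ((hφ.const_mul I).cexp).mul hψ.hasFDerivAt
  rw [hmul.fderiv]
  simp
  ring

theorem IsMagDeriv.phaseOp_gauge {A : E d → E d} {j : Fin d} {u v : L2 d}
    (h : IsMagDeriv A j u v) (φ : 𝓢(E d, ℝ)) :
    IsMagDeriv (gauge A φ) j (phaseOp φ u) (phaseOp φ v) := by
  intro ψ hψ
  obtain ⟨hint, heq⟩ := h _ (hψ.mulPhase φ)
  have hleft : (fun x => u x * (I * fderiv ℝ (mulPhase φ ψ) x (EuclideanSpace.single j 1) -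
      ((A x j : ℝ) : ℂ) * mulPhase φ ψ x)) =ᵐ[volume]
      fun x => phaseOp φ u x * (I * fderiv ℝ ψ x (EuclideanSpace.single j 1) -
      ((gauge A φ x j : ℝ) : ℂ) * ψ x) := by
    filter_upwards [coeFn_phaseOp φ u] with x hx
    rw [hx, fderiv_mulPhase φ (hψ.1.differentiable (by simp) x), mulPhase, mulPhase, gauge,
      PiLp.add_apply, gradient_apply]
    push_cast
    linear_combination (cexp (I * ((φ x : ℝ) : ℂ)) * u x *
      ((fderiv ℝ φ x (EuclideanSpace.single j 1) : ℝ) : ℂ) * ψ x) * I_mul_I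
  have hright : (fun x => v x * mulPhase φ ψ x) =ᵐ[volume] fun x => phaseOp φ v x * ψ x := by
    filter_upwards [coeFn_phaseOp φ v] with x hx
    rw [hx, mulPhase, mulPhase]
    ring
  exact ⟨hint.congr hleft, by rw [← integral_congr_ae hleft, heq, integral_congr_ae hright]⟩

theorem phaseOp_mem_magGraph_gauge {m : ℝ} {A : E d → E d} {u w : L2 d}
    (h : (u, w) ∈ magGraph m A) (φ : 𝓢(E d, ℝ)) :
    (phaseOp φ u, phaseOp φ w) ∈ magGraph m (gauge A φ) := by
  obtain ⟨p, hp, h⟩ := h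
  refine ⟨fun j => phaseOp φ (p j), fun j => (hp j).phaseOp_gauge φ, fun v q hq => ?_⟩
  have hq' : ∀ j, IsMagDeriv A j (phaseOp (-φ) v) (phaseOp (-φ) (q j)) := fun j => by
    simpa only [gauge_gauge_neg] using (hq j).phaseOp_gauge (-φ)
  simpa only [inner_phaseOp_left, neg_neg] using h _ _ hq'

theorem phaseOp_mem_magGraph_gauge_iff {m : ℝ} {A : E d → E d} (φ : 𝓢(E d, ℝ)) (u w : L2 d) :
    (phaseOp φ u, phaseOp φ w) ∈ magGraph m (gauge A φ) ↔ (u, w) ∈ magGraph m A := by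
  refine ⟨fun h => ?_, fun h => phaseOp_mem_magGraph_gauge h φ⟩
  simpa only [gauge_gauge_neg, phaseOp_neg_phaseOp] using phaseOp_mem_magGraph_gauge h (-φ)

theorem H3_gauge (m : ℝ) {A : E d → E d} (hA : IsL2Loc A) (φ : 𝓢(E d, ℝ)) :
    H3 m (gauge A φ) = gaugeConj φ (H3 m A) := by
  have hH3 : ∀ {B : E d → E d}, IsL2Loc B → IsNonnegSqrt (H3 m B) (magGraph m B) := fun hB =>
    Classical.epsilon_spec (existsUnique_isNonnegSqrt m hB).exists
  have hconj := (isNonnegSqrt_iff_isGraphSqrt.1 (hH3 hA)).congr_isometryEquiv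
    (phaseEquiv φ) (mem_gaugeConj_graph φ _) (phaseOp_mem_magGraph_gauge_iff φ)
  exact (existsUnique_isNonnegSqrt m (hA.gauge φ)).unique (hH3 (hA.gauge φ))
    (isNonnegSqrt_iff_isGraphSqrt.2 hconj)

end Phase

/-! ### Uniform decay of Fourier transforms -/

section DerivativeBounds

variable {V F : Type*} [NormedAddCommGroup V] [NormedSpace ℝ V] [NormedAddCommGroup F]
  [NormedSpace ℝ F]

theorem exists_forall_norm_iteratedFDeriv_le {b : V → F} (hb : ContDiff ℝ ∞ b) {K : Set V}
    (hK : IsCompact K) (N : ℕ) :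
    ∃ D, 1 ≤ D ∧ ∀ n ≤ N, ∀ y ∈ K, ‖iteratedFDeriv ℝ n b y‖ ≤ D := by
  have hcont : ∀ n : ℕ, Continuous (iteratedFDeriv ℝ n b) := fun n =>
    hb.continuous_iteratedFDeriv (by exact_mod_cast le_top)
  obtain ⟨D, hD⟩ := hK.exists_bound_of_continuousOn
    (f := fun y => ∑ n ∈ Finset.range (N + 1), ‖iteratedFDeriv ℝ n b y‖)
    (continuous_finsetSum _ fun n _ => (hcont n).norm).continuousOn
  refine ⟨max 1 D, le_max_left _ _, fun n hn y hy => ?_⟩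
  calc ‖iteratedFDeriv ℝ n b y‖
      ≤ ∑ n ∈ Finset.range (N + 1), ‖iteratedFDeriv ℝ n b y‖ :=
        Finset.single_le_sum (f := fun n => ‖iteratedFDeriv ℝ n b y‖)
          (fun _ _ => norm_nonneg _) (Finset.mem_range.2 (Nat.lt_succ_of_le hn))
    _ ≤ D := (Real.le_norm_self _).trans (hD y hy)
    _ ≤ max 1 D := le_max_right _ _

theorem norm_iteratedFDeriv_comp_mul_le {Φ : F → ℂ} {h : V → F} {g : V → ℂ}
    (hΦ : ContDiff ℝ ∞ Φ) (hh : ContDiff ℝ ∞ h) (hg : ContDiff ℝ ∞ g) {y : V} {n : ℕ}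
    {P D Q : ℝ} (hD : 1 ≤ D) (hΦb : ∀ k ≤ n, ‖iteratedFDeriv ℝ k Φ (h y)‖ ≤ P)
    (hhb : ∀ k, 1 ≤ k → k ≤ n → ‖iteratedFDeriv ℝ k h y‖ ≤ D)
    (hgb : ∀ k ≤ n, ‖iteratedFDeriv ℝ k g y‖ ≤ Q) :
    ‖iteratedFDeriv ℝ n (fun y => Φ (h y) * g y) y‖ ≤ 2 ^ n * (n.factorial * P * D ^ n * Q) := by
  have hP : 0 ≤ P := (norm_nonneg _).trans (hΦb 0 n.zero_le)
  have hcomp : ∀ k ≤ n, ‖iteratedFDeriv ℝ k (Φ ∘ h) y‖ ≤ n.factorial * P * D ^ n := fun k hk => by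
    refine (norm_iteratedFDeriv_comp_le hΦ hh (by exact_mod_cast le_top) y
      (fun i hi => hΦb i (hi.trans hk)) fun i h1 hi =>
        (hhb i h1 (hi.trans hk)).trans (le_self_pow₀ hD (by omega))).trans ?_
    gcongr
  calc ‖iteratedFDeriv ℝ n (fun y => (Φ ∘ h) y * g y) y‖
      ≤ ∑ k ∈ Finset.range (n + 1), (n.choose k : ℝ) * ‖iteratedFDeriv ℝ k (Φ ∘ h) y‖ *
          ‖iteratedFDeriv ℝ (n - k) g y‖ :=
        norm_iteratedFDeriv_mul_le (hΦ.comp hh) hg y (by exact_mod_cast le_top)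
    _ ≤ ∑ k ∈ Finset.range (n + 1), (n.choose k : ℝ) * (n.factorial * P * D ^ n) * Q := by
        refine Finset.sum_le_sum fun k hk => ?_
        gcongr
        · exact hcomp k (Nat.lt_succ_iff.1 (Finset.mem_range.1 hk))
        · exact hgb _ (n.sub_le k)
    _ = 2 ^ n * (n.factorial * P * D ^ n * Q) := by
        simp only [mul_assoc, ← Finset.sum_mul]
        rw [← Nat.cast_sum, Nat.sum_range_choose]
        push_cast
        rfl

theorem exists_norm_iteratedFDeriv_comp_add_smul_mul_le (Φ : 𝓢(F, ℂ)) {b : V → F}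
    (hb : ContDiff ℝ ∞ b) {g : V → ℂ} (hg : ContDiff ℝ ∞ g) {K : Set V} (hK : IsCompact K)
    (n : ℕ) : ∃ C, ∀ ε ∈ Set.Ioc (0 : ℝ) 1, ∀ c : F, ∀ y ∈ K,
      ‖iteratedFDeriv ℝ n (fun y => Φ (c + ε • b y) * g y) y‖ ≤ C := by
  obtain ⟨D, hD1, hD⟩ := exists_forall_norm_iteratedFDeriv_le hb hK n
  obtain ⟨Q, -, hQ⟩ := exists_forall_norm_iteratedFDeriv_le hg hK n
  set P : ℝ := (Finset.Iic (0, n)).sup (fun i => SchwartzMap.seminorm ℝ i.1 i.2) Φ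
  refine ⟨2 ^ n * (n.factorial * P * D ^ n * Q), fun ε hε c y hy =>
    norm_iteratedFDeriv_comp_mul_le (Φ.smooth ⊤) (contDiff_const.add (hb.const_smul ε)) hg hD1
      (fun k hk => ?_) (fun k hk hkn => ?_) fun k hk => hQ k hk y hy⟩
  · simpa using SchwartzMap.one_add_le_sup_seminorm_apply (𝕜 := ℝ) (k := 0) (m := (0, n)) le_rfl hk
      Φ (c + ε • b y)
  · have hderiv : iteratedFDeriv ℝ k (fun y => c + ε • b y) y = ε • iteratedFDeriv ℝ k b y := by
      rw [fun_iteratedFDeriv_add_apply contDiffAt_const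
        ((hb.const_smul ε).contDiffAt.of_le (by exact_mod_cast le_top)),
        iteratedFDeriv_const_of_ne (by omega), Pi.zero_apply, zero_add]
      exact iteratedFDeriv_const_smul_apply' (hb.contDiffAt.of_le (by exact_mod_cast le_top))
    rw [hderiv, norm_smul, Real.norm_of_nonneg hε.1.le]
    exact (mul_le_of_le_one_left (norm_nonneg _) hε.2).trans (hD k hkn y hy)

end DerivativeBounds

section FourierDecay

variable {V : Type*} [NormedAddCommGroup V] [InnerProductSpace ℝ V] [FiniteDimensional ℝ V]
  [MeasurableSpace V] [BorelSpace V]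

theorem exists_norm_fourier_le_of_isVonNBounded {S : Set 𝓢(V, ℂ)}
    (hS : Bornology.IsVonNBounded ℂ S) (N : ℕ) :
    ∃ M : ℝ, ∀ G ∈ S, ∀ w, ‖𝓕 (G : V → ℂ) w‖ ≤ M * ((1 + ‖w‖) ^ N)⁻¹ := by
  have himage := hS.image (SchwartzMap.fourierTransformCLM ℂ : 𝓢(V, ℂ) →L[ℂ] 𝓢(V, ℂ))
  obtain ⟨r, -, hr⟩ := (schwartz_withSeminorms ℂ V ℂ).isVonNBounded_iff_finset_seminorm_bounded.1
    himage (Finset.Iic (N, 0))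
  refine ⟨2 ^ N * r, fun G hG w => ?_⟩
  have hdecay := SchwartzMap.one_add_le_sup_seminorm_apply (𝕜 := ℂ) (m := (N, 0)) le_rfl le_rfl
    (SchwartzMap.fourierTransformCLM ℂ G) w
  rw [norm_iteratedFDeriv_zero] at hdecay
  rw [← div_eq_mul_inv, le_div_iff₀' (by positivity)]
  refine hdecay.trans ?_
  gcongr
  exact (hr _ (Set.mem_image_of_mem _ hG)).le

theorem exists_norm_fourier_le (G : 𝓢(V, ℂ)) (N : ℕ) :
    ∃ M : ℝ, ∀ w, ‖𝓕 (G : V → ℂ) w‖ ≤ M * ((1 + ‖w‖) ^ N)⁻¹ := by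
  simpa using exists_norm_fourier_le_of_isVonNBounded
    (Bornology.isVonNBounded_singleton (𝕜 := ℂ) G) N

theorem exists_norm_fourier_le_of_tsupport_subset {ι : Type*} {G : ι → V → ℂ} {K : Set V}
    (hK : IsCompact K) (hG : ∀ i, ContDiff ℝ ∞ (G i)) (hGK : ∀ i, tsupport (G i) ⊆ K)
    (hbound : ∀ n, ∃ C, ∀ i, ∀ y ∈ K, ‖iteratedFDeriv ℝ n (G i) y‖ ≤ C) (N : ℕ) :
    ∃ M : ℝ, ∀ i w, ‖𝓕 (G i) w‖ ≤ M * ((1 + ‖w‖) ^ N)⁻¹ := by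
  have hcompact : ∀ i, HasCompactSupport (G i) := fun i =>
    hK.of_isClosed_subset (isClosed_tsupport _) (hGK i)
  obtain ⟨R, hR⟩ := hK.exists_bound_of_continuousOn (f := fun y => y) continuousOn_id
  have hS : Bornology.IsVonNBounded ℂ
      (Set.range fun i => (hcompact i).toSchwartzMap (hG i)) := by
    rw [(schwartz_withSeminorms ℂ V ℂ).isVonNBounded_iff_seminorm_bddAbove]
    rintro ⟨k, n⟩
    obtain ⟨C, hC⟩ := hbound n
    refine ⟨|R| ^ k * |C|, ?_⟩
    rintro _ ⟨_, ⟨i, rfl⟩, rfl⟩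
    refine SchwartzMap.seminorm_le_bound ℂ k n _ (by positivity) fun y => ?_
    by_cases hy : y ∈ K
    · gcongr
      · exact (hR y hy).trans (le_abs_self R)
      · exact (hC i y hy).trans (le_abs_self C)
    · have hzero : iteratedFDeriv ℝ n (G i) y = 0 := image_eq_zero_of_notMem_tsupport
        fun h => hy (hGK i (tsupport_iteratedFDeriv_subset n h))
      change ‖y‖ ^ k * ‖iteratedFDeriv ℝ n (G i) y‖ ≤ _
      rw [hzero, norm_zero, mul_zero]
      positivity
  obtain ⟨M, hM⟩ := exists_norm_fourier_le_of_isVonNBounded hS N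
  exact ⟨M, fun i => hM _ (Set.mem_range_self i)⟩

end FourierDecay

/-! ### The operator `√(-Δ + m²)` at the origin -/

theorem sqrt_sq_add_sq_le {a : ℝ} (ha : 0 ≤ a) (m : ℝ) : √(a ^ 2 + m ^ 2) ≤ a + |m| := by
  rw [Real.sqrt_le_left (by positivity)]
  nlinarith [sq_abs m, abs_nonneg m]

section SqrtLaplace

variable {V : Type*} [NormedAddCommGroup V]

/-- The symbol `√(|ξ|² + m²)` of `√(-Δ + m²)` at `ξ = 2πw`, where `w` is the frequency variable of
the Fourier transform `𝓕`, whose kernel is `e^{-2πi⟨y,w⟩}`. -/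
def sqrtSymbol (m : ℝ) (w : V) : ℝ := √((2 * Real.pi * ‖w‖) ^ 2 + m ^ 2)

theorem sqrtSymbol_nonneg (m : ℝ) (w : V) : 0 ≤ sqrtSymbol m w := Real.sqrt_nonneg _

theorem continuous_sqrtSymbol (m : ℝ) : Continuous (sqrtSymbol m : V → ℝ) := by
  unfold sqrtSymbol
  fun_prop

theorem sqrtSymbol_le (m : ℝ) (w : V) : sqrtSymbol m w ≤ (2 * Real.pi + |m|) * (1 + ‖w‖) := by
  refine (sqrt_sq_add_sq_le (by positivity) m).trans ?_
  nlinarith [Real.pi_pos, mul_nonneg (abs_nonneg m) (norm_nonneg w)]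

variable [InnerProductSpace ℝ V] [FiniteDimensional ℝ V] [MeasurableSpace V] [BorelSpace V]

theorem integrable_sqrtSymbol_mul_decay (m M : ℝ) :
    Integrable fun w : V =>
      sqrtSymbol m w * (M * ((1 + ‖w‖) ^ (Module.finrank ℝ V + 2))⁻¹) := by
  set n := Module.finrank ℝ V
  have hdecay : Integrable fun w : V => (1 + ‖w‖) ^ (-((n + 1 : ℕ) : ℝ)) :=
    integrable_one_add_norm (by simp [n])
  have hcont : Continuous fun w : V => sqrtSymbol m w * (M * ((1 + ‖w‖) ^ (n + 2))⁻¹) :=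
    (continuous_sqrtSymbol m).mul (continuous_const.mul
      (Continuous.inv₀ (by fun_prop) fun w => by positivity))
  refine (hdecay.const_mul ((2 * Real.pi + |m|) * |M|)).mono' hcont.aestronglyMeasurable
    (ae_of_all _ fun w => ?_)
  rw [Real.rpow_neg (by positivity), Real.rpow_natCast, Real.norm_eq_abs, abs_mul, abs_mul,
    abs_of_nonneg (sqrtSymbol_nonneg m w), abs_of_nonneg (by positivity : 0 ≤ (_ : ℝ)⁻¹)]
  calc sqrtSymbol m w * (|M| * ((1 + ‖w‖) ^ (n + 2))⁻¹)
      ≤ (2 * Real.pi + |m|) * (1 + ‖w‖) * (|M| * ((1 + ‖w‖) ^ (n + 2))⁻¹) := by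
        gcongr
        exact sqrtSymbol_le m w
    _ = (2 * Real.pi + |m|) * |M| * ((1 + ‖w‖) ^ (n + 1))⁻¹ := by
        rw [pow_succ (1 + ‖w‖) (n + 1)]
        field_simp

/-- The value `(√(-Δ + m²) g)(0)`, by Fourier inversion. -/
def sqrtLaplaceAtZero (m : ℝ) (g : V → ℂ) : ℂ := ∫ w, (sqrtSymbol m w : ℂ) * 𝓕 g w

theorem sqrtLaplaceAtZero_const_mul (m : ℝ) (c : ℂ) (g : V → ℂ) :
    sqrtLaplaceAtZero m (fun y => c * g y) = c * sqrtLaplaceAtZero m g := by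
  simp only [sqrtLaplaceAtZero, Real.fourier_eq', smul_eq_mul, mul_left_comm _ c,
    integral_const_mul]

end SqrtLaplace

/-! ### Evaluation of the oscillatory integrals -/

section Oscillatory

variable {d : ℕ}

theorem norm_cexp_neg_I_mul (t : ℝ) : ‖cexp (-I * (t : ℂ))‖ = 1 := by
  rw [neg_mul, mul_comm, ← neg_mul, ← ofReal_neg, Complex.norm_exp_ofReal_mul_I]

theorem exists_sqrt_mul_norm_le (m : ℝ) {B : E d → E d} (hB : Continuous B) {F : E d → ℂ}
    (hF : Continuous F) (hFc : HasCompactSupport F) :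
    ∃ C, ∀ ξ y, √(‖ξ - B y‖ ^ 2 + m ^ 2) * ‖F y‖ ≤ C * (1 + ‖ξ‖) := by
  obtain ⟨C, hC⟩ := (hFc.norm.mul_left (f := fun y => 1 + ‖B y‖ + |m|)).exists_bound_of_continuous
    (by fun_prop)
  refine ⟨C, fun ξ y => ?_⟩
  have hsqrt : √(‖ξ - B y‖ ^ 2 + m ^ 2) ≤ (1 + ‖B y‖ + |m|) * (1 + ‖ξ‖) := by
    refine (sqrt_sq_add_sq_le (norm_nonneg _) m).trans ?_
    nlinarith [norm_sub_le ξ (B y), mul_nonneg (add_nonneg (norm_nonneg (B y)) (abs_nonneg m))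
      (norm_nonneg ξ)]
  calc √(‖ξ - B y‖ ^ 2 + m ^ 2) * ‖F y‖
      ≤ (1 + ‖B y‖ + |m|) * (1 + ‖ξ‖) * ‖F y‖ := by gcongr
    _ = (1 + ‖B y‖ + |m|) * ‖F y‖ * (1 + ‖ξ‖) := by ring
    _ ≤ C * (1 + ‖ξ‖) := by
        gcongr
        exact (Real.le_norm_self _).trans (hC y)

theorem integrable_cutoff_amplitude (m : ℝ) {B : E d → E d} (hB : Continuous B) {F : E d → ℂ}
    (hF : Continuous F) (hFc : HasCompactSupport F) (χ : 𝓢(E d × E d, ℂ)) {ε : ℝ} (hε : ε ≠ 0) :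
    Integrable fun p : E d × E d => cexp (-I * ((⟪p.2, p.1⟫_ℝ : ℝ) : ℂ)) *
      χ (ε • p.1, ε • p.2) * ((√(‖p.1 - B p.2‖ ^ 2 + m ^ 2) : ℝ) * F p.2) := by
  have hhaar : (volume : Measure (E d × E d)).IsAddHaarMeasure := by
    rw [Measure.volume_eq_prod]
    infer_instance
  have hχc := χ.continuous
  obtain ⟨C, hC⟩ := exists_sqrt_mul_norm_le m hB hF hFc
  have hχ0 : Integrable fun p : E d × E d => ‖χ (ε • p)‖ := (χ.integrable.comp_smul hε).norm
  have hχ1 : Integrable fun p : E d × E d => ‖p‖ * ‖χ (ε • p)‖ := by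
    refine (((χ.integrable_pow_mul volume 1).comp_smul hε).const_mul |ε|⁻¹).congr
      (ae_of_all _ fun p => ?_)
    have := abs_ne_zero.2 hε
    simp only [pow_one, norm_smul, Real.norm_eq_abs]
    field_simp
  refine ((hχ0.add hχ1).const_mul C).mono' (by fun_prop) (ae_of_all _ fun p => ?_)
  rw [norm_mul, norm_mul, norm_mul, norm_cexp_neg_I_mul, one_mul, norm_real,
    Real.norm_of_nonneg (Real.sqrt_nonneg _)]
  have hC0 : 0 ≤ C := by
    simpa using (mul_nonneg (Real.sqrt_nonneg _) (norm_nonneg _)).trans (hC 0 0)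
  calc ‖χ (ε • p)‖ * (√(‖p.1 - B p.2‖ ^ 2 + m ^ 2) * ‖F p.2‖)
      ≤ ‖χ (ε • p)‖ * (C * (1 + ‖p‖)) :=
        mul_le_mul_of_nonneg_left
          ((hC _ _).trans (by gcongr; exact norm_fst_le p)) (norm_nonneg _)
    _ = C * (‖χ (ε • p)‖ + ‖p‖ * ‖χ (ε • p)‖) := by ring

theorem measurePreserving_shear {B : E d → E d} (hB : Continuous B) :
    MeasurePreserving fun p : E d × E d => (p.1 + B p.2, p.2) := by
  have hskew : MeasurePreserving (fun p : E d × E d => (p.1, p.2 + B p.1))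
      (volume.prod volume) (volume.prod volume) :=
    (MeasurePreserving.id volume).skew_product (g := fun a c => c + B a)
      (by fun_prop) (ae_of_all _ fun a => (measurePreserving_add_right volume (B a)).map_eq)
  have hswap : MeasurePreserving (Prod.swap : E d × E d → E d × E d)
      (volume.prod volume) (volume.prod volume) := Measure.measurePreserving_swap
  exact hswap.comp (hskew.comp hswap)

/-- The function `e^{-i⟨y, B(y)⟩} F(y)`: the part of the phase that the substitution
`ξ = ζ + B(y)` splits off from `e^{-i⟨y, ξ⟩}`, absorbed into `F`. -/
def twist (B : E d → E d) (F : E d → ℂ) : E d → ℂ :=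
  fun y => cexp (-I * ((⟪y, B y⟫_ℝ : ℝ) : ℂ)) * F y

theorem IsTest.twist {B : E d → E d} (hB : ContDiff ℝ ∞ B) {F : E d → ℂ} (hF : IsTest F) :
    IsTest (MagRel.twist B F) :=
  hF.mul_left (contDiff_const.mul (ofRealCLM.contDiff.comp (contDiff_id.inner ℝ hB))).cexp

/-- The function `y ↦ χ(εξ, εy) g(y)` with `ξ = 2πw + B(y)`: the cutoff of the regularized integral
in the frequency variable `w`. -/
def cutoffMul (χ : 𝓢(E d × E d, ℂ)) (B : E d → E d) (g : E d → ℂ) (ε : ℝ) (w : E d) : E d → ℂ :=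
  fun y => χ (ε • ((2 * Real.pi) • w + B y), ε • y) * g y

theorem integral_cutoff_amplitude (m : ℝ) {B : E d → E d} (hB : Continuous B) {F : E d → ℂ}
    (hF : Continuous F) (hFc : HasCompactSupport F) (χ : 𝓢(E d × E d, ℂ)) {ε : ℝ} (hε : ε ≠ 0) :
    ∫ p : E d × E d, cexp (-I * ((⟪p.2, p.1⟫_ℝ : ℝ) : ℂ)) *
      χ (ε • p.1, ε • p.2) * ((√(‖p.1 - B p.2‖ ^ 2 + m ^ 2) : ℝ) * F p.2) =
    ((2 * Real.pi) ^ d : ℝ) *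
      ∫ w, (sqrtSymbol m w : ℂ) * 𝓕 (cutoffMul χ B (twist B F) ε w) w := by
  set h : E d × E d → ℂ := fun p => cexp (-I * ((⟪p.2, p.1⟫_ℝ : ℝ) : ℂ)) *
    χ (ε • p.1, ε • p.2) * ((√(‖p.1 - B p.2‖ ^ 2 + m ^ 2) : ℝ) * F p.2)
  have hint : Integrable h := integrable_cutoff_amplitude m hB hF hFc χ hε
  have hshear := measurePreserving_shear hB
  have hslice : ∀ w : E d, ∫ y, h ((2 * Real.pi) • w + B y, y) =
      (sqrtSymbol m w : ℂ) * 𝓕 (cutoffMul χ B (twist B F) ε w) w := fun w => by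
    rw [Real.fourier_eq', ← integral_const_mul]
    refine integral_congr_ae (ae_of_all _ fun y => ?_)
    have hnorm : ‖(2 * Real.pi) • w‖ = 2 * Real.pi * ‖w‖ := by
      rw [norm_smul, Real.norm_of_nonneg (by positivity)]
    simp only [h, cutoffMul, twist, sqrtSymbol, add_sub_cancel_right, hnorm, inner_add_right,
      inner_smul_right, ofReal_add, mul_add, Complex.exp_add, smul_eq_mul]
    push_cast
    ring_nf
  calc ∫ p, h p = ∫ p : E d × E d, h (p.1 + B p.2, p.2) := by
        rw [← integral_map hshear.aemeasurable
          (hshear.map_eq.symm ▸ hint.aestronglyMeasurable), hshear.map_eq]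
    _ = ∫ ζ, ∫ y, h (ζ + B y, y) := integral_prod _ (hshear.integrable_comp_of_integrable hint)
    _ = ((2 * Real.pi) ^ d : ℝ) * ∫ w : E d, ∫ y, h ((2 * Real.pi) • w + B y, y) := by
        rw [Measure.integral_comp_smul volume fun ζ => ∫ y, h (ζ + B y, y),
          finrank_euclideanSpace_fin, abs_of_pos (by positivity), real_smul, ← mul_assoc,
          ← ofReal_mul, mul_inv_cancel₀ (by positivity), ofReal_one, one_mul]
    _ = _ := by simp only [hslice]

theorem tendsto_fourier_cutoffMul {χ : 𝓢(E d × E d, ℂ)} (hχ : χ (0, 0) = 1) {B : E d → E d}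
    (hB : Continuous B) {g : E d → ℂ} (hg : Continuous g) (hgi : Integrable g) (w : E d) :
    Tendsto (fun ε => 𝓕 (cutoffMul χ B g ε w) w) (𝓝[>] 0) (𝓝 (𝓕 g w)) := by
  have hχc := χ.continuous
  obtain ⟨D, -, hD⟩ := χ.decay 0 0
  simp only [pow_zero, one_mul, norm_iteratedFDeriv_zero] at hD
  simp only [Real.fourier_eq', smul_eq_mul, cutoffMul]
  refine tendsto_integral_filter_of_dominated_convergence (fun y => D * ‖g y‖)
    (Eventually.of_forall fun ε => by fun_prop) (Eventually.of_forall fun ε => ae_of_all _ fun y =>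
      ?_) (hgi.norm.const_mul D) (ae_of_all _ fun y => ?_)
  · rw [norm_mul, norm_mul, Complex.norm_exp_ofReal_mul_I, one_mul]
    gcongr
    exact hD _
  · have hcont : Continuous fun ε : ℝ => cexp (((-2 * Real.pi * ⟪y, w⟫_ℝ : ℝ) : ℂ) * I) *
        (χ (ε • ((2 * Real.pi) • w + B y), ε • y) * g y) := by fun_prop
    simpa [hχ] using (hcont.tendsto 0).mono_left (nhdsWithin_le_nhds (s := Set.Ioi 0))

theorem aestronglyMeasurable_fourier_cutoffMul (χ : 𝓢(E d × E d, ℂ)) {B : E d → E d}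
    (hB : Continuous B) {g : E d → ℂ} (hg : Continuous g) (ε : ℝ) :
    AEStronglyMeasurable fun w => 𝓕 (cutoffMul χ B g ε w) w := by
  have hχc := χ.continuous
  simp only [Real.fourier_eq', cutoffMul]
  have hcont : Continuous fun p : E d × E d => cexp (((-2 * Real.pi * ⟪p.2, p.1⟫_ℝ : ℝ) : ℂ) * I) •
      (χ (ε • ((2 * Real.pi) • p.1 + B p.2), ε • p.2) * g p.2) := by fun_prop
  exact hcont.stronglyMeasurable.integral_prod_right'.aestronglyMeasurable

theorem exists_norm_fourier_cutoffMul_le (χ : 𝓢(E d × E d, ℂ)) {B : E d → E d}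
    (hB : ContDiff ℝ ∞ B) {g : E d → ℂ} (hg : IsTest g) (N : ℕ) :
    ∃ M, ∀ ε ∈ Set.Ioc (0 : ℝ) 1, ∀ w,
      ‖𝓕 (cutoffMul χ B g ε w) w‖ ≤ M * ((1 + ‖w‖) ^ N)⁻¹ := by
  have hgs := hg.1
  have hχs := χ.smooth ⊤
  have hbound : ∀ n, ∃ C, ∀ i : Set.Ioc (0 : ℝ) 1 × E d, ∀ y ∈ tsupport g,
      ‖iteratedFDeriv ℝ n (cutoffMul χ B g i.1 i.2) y‖ ≤ C := fun n => by
    obtain ⟨C, hC⟩ := exists_norm_iteratedFDeriv_comp_add_smul_mul_le χ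
      (hB.prodMk contDiff_id) hgs hg.2 n
    refine ⟨C, fun ⟨⟨ε, hε⟩, w⟩ y hy => ?_⟩
    have hshift : cutoffMul χ B g ε w =
        fun y => χ (ε • ((2 * Real.pi) • w, (0 : E d)) + ε • (B y, y)) * g y := by
      funext y
      rw [← smul_add, Prod.mk_add_mk, zero_add, Prod.smul_mk, cutoffMul]
    change ‖iteratedFDeriv ℝ n (cutoffMul χ B g ε w) y‖ ≤ C
    rw [hshift]
    exact hC ε hε _ y hy
  obtain ⟨M, hM⟩ := exists_norm_fourier_le_of_tsupport_subset
    (G := fun i : Set.Ioc (0 : ℝ) 1 × E d => cutoffMul χ B g i.1 i.2) hg.2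
    (fun i => by unfold cutoffMul; fun_prop) (fun i => tsupport_mul_subset_right) hbound N
  exact ⟨M, fun ε hε w => hM (⟨ε, hε⟩, w) w⟩

theorem hasOscIntegral_sqrt (m : ℝ) {B : E d → E d} (hB : ContDiff ℝ ∞ B) {F : E d → ℂ}
    (hF : IsTest F) :
    HasOscIntegral (fun ξ y => ((√(‖ξ - B y‖ ^ 2 + m ^ 2) : ℝ) : ℂ) * F y)
      (((2 * Real.pi) ^ d : ℝ) * sqrtLaplaceAtZero m (twist B F)) := by
  intro χ hχ
  have hFc := hF.1.continuous
  refine ⟨fun ε hε => integrable_cutoff_amplitude m hB.continuous hFc hF.2 χ hε.ne', ?_⟩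
  have hg := hF.twist hB
  obtain ⟨M, hM⟩ := exists_norm_fourier_cutoffMul_le χ hB hg (Module.finrank ℝ (E d) + 2)
  have hlim : Tendsto
      (fun ε => ∫ w, (sqrtSymbol m w : ℂ) * 𝓕 (cutoffMul χ B (twist B F) ε w) w) (𝓝[>] 0)
      (𝓝 (sqrtLaplaceAtZero m (twist B F))) := by
    refine tendsto_integral_filter_of_dominated_convergence _ (Eventually.of_forall fun ε => ?_) ?_
      (integrable_sqrtSymbol_mul_decay m M) (ae_of_all _ fun w => ?_)
    · exact (continuous_ofReal.comp (continuous_sqrtSymbol m)).aestronglyMeasurable.mul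
        (aestronglyMeasurable_fourier_cutoffMul χ hB.continuous hg.1.continuous ε)
    · filter_upwards [Ioc_mem_nhdsGT (zero_lt_one' ℝ)] with ε hε
      refine ae_of_all _ fun w => ?_
      rw [norm_mul, norm_real, Real.norm_of_nonneg (sqrtSymbol_nonneg m w)]
      exact mul_le_mul_of_nonneg_left (hM ε hε w) (sqrtSymbol_nonneg m w)
    · exact (tendsto_fourier_cutoffMul hχ hB.continuous hg.1.continuous
        (hg.1.continuous.integrable_of_hasCompactSupport hg.2) w).const_mul _
  refine (hlim.const_mul _).congr' ?_
  filter_upwards [self_mem_nhdsWithin] with ε hε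
  exact (integral_cutoff_amplitude m hB.continuous hFc hF.2 χ (ne_of_gt hε)).symm

theorem IsTest.translate {f : E d → ℂ} (hf : IsTest f) (x : E d) : IsTest fun y => f (x + y) :=
  ⟨hf.1.comp (contDiff_const.add contDiff_id), hf.2.comp_homeomorph (Homeomorph.addLeft x)⟩

theorem hasOscIntegral_amplitude (m : ℝ) {B : E d → E d → E d} {x : E d}
    (hB : ContDiff ℝ ∞ fun y => B x (x + y)) {f : E d → ℂ} (hf : IsTest f) :
    HasOscIntegral (amplitude m B f x) (((2 * Real.pi) ^ d : ℝ) *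
      sqrtLaplaceAtZero m (twist (fun y => B x (x + y)) fun y => f (x + y))) :=
  hasOscIntegral_sqrt m hB (hf.translate x)

theorem HasOscIntegral.unique {a : E d → E d → ℂ} {L L' : ℂ} (h : HasOscIntegral a L)
    (h' : HasOscIntegral a L') : L = L' := by
  let b : ContDiffBump (0 : E d × E d) := ⟨1, 2, one_pos, one_lt_two⟩
  have hb : HasCompactSupport fun p => ((b p : ℝ) : ℂ) :=
    b.hasCompactSupport.comp_left (g := fun t : ℝ => (t : ℂ)) ofReal_zero
  let χ : 𝓢(E d × E d, ℂ) := hb.toSchwartzMap (ofRealCLM.contDiff.comp b.contDiff)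
  have hχ : χ (0, 0) = 1 := by
    change ((b 0 : ℝ) : ℂ) = 1
    rw [b.one_of_mem_closedBall (Metric.mem_closedBall_self b.rIn_pos.le), ofReal_one]
  exact tendsto_nhds_unique (h χ hχ).2 (h' χ hχ).2

theorem HasOscIntegral.oscIntegral_eq {a : E d → E d → ℂ} {L : ℂ} (h : HasOscIntegral a L) :
    oscIntegral a = L := by
  have hex : ∃ L, HasOscIntegral a L := ⟨L, h⟩
  rw [oscIntegral, dif_pos hex]
  exact hex.choose_spec.unique h

theorem pseudoDiff_eq (m : ℝ) {B : E d → E d → E d} {x : E d}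
    (hB : ContDiff ℝ ∞ fun y => B x (x + y)) {f : E d → ℂ} (hf : IsTest f) :
    pseudoDiff m B f x =
      sqrtLaplaceAtZero m (twist (fun y => B x (x + y)) fun y => f (x + y)) := by
  have hpi : (((2 * Real.pi) ^ d : ℝ) : ℂ) ≠ 0 := ofReal_ne_zero.2 (by positivity)
  rw [pseudoDiff, (hasOscIntegral_amplitude m hB hf).oscIntegral_eq, inv_mul_cancel_left₀ hpi]

end Oscillatory

/-! ### Smoothness of the averaged potential -/

section ParametricIntegral

universe u

variable {V W : Type u} [NormedAddCommGroup V] [NormedSpace ℝ V] [ProperSpace V]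
  [NormedAddCommGroup W] [NormedSpace ℝ W]

theorem hasFDerivAt_intervalIntegral_of_contDiff {F : V × ℝ → W} (hF : ContDiff ℝ 1 F) (y₀ : V) :
    HasFDerivAt (fun y => ∫ θ in (0 : ℝ)..1, F (y, θ))
      (∫ θ in (0 : ℝ)..1, (fderiv ℝ F (y₀, θ)).comp (ContinuousLinearMap.inl ℝ V ℝ)) y₀ := by
  have hFc := hF.continuous
  have hpartial : Continuous fun p : V × ℝ =>
      (fderiv ℝ F p).comp (ContinuousLinearMap.inl ℝ V ℝ) := by fun_prop
  obtain ⟨C, hC⟩ := ((isCompact_closedBall y₀ 1).prod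
    (isCompact_Icc (a := (0 : ℝ)) (b := 1))).exists_bound_of_continuousOn hpartial.continuousOn
  refine intervalIntegral.hasFDerivAt_integral_of_dominated_of_fderiv_le
    (F := fun y θ => F (y, θ)) (bound := fun _ => C)
    (F' := fun y θ => (fderiv ℝ F (y, θ)).comp (ContinuousLinearMap.inl ℝ V ℝ))
    (Metric.ball_mem_nhds y₀ one_pos)
    (Eventually.of_forall fun y => Continuous.aestronglyMeasurable (by fun_prop))
    (Continuous.intervalIntegrable (by fun_prop) _ _)
    (Continuous.aestronglyMeasurable (by fun_prop))
    (ae_of_all _ fun θ hθ y hy => hC (y, θ) ⟨Metric.ball_subset_closedBall hy, ?_⟩)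
    intervalIntegrable_const (ae_of_all _ fun θ _ y _ => ?_)
  · rw [Set.uIoc_of_le zero_le_one] at hθ
    exact Set.Ioc_subset_Icc_self hθ
  · exact (hF.differentiable one_ne_zero (y, θ)).hasFDerivAt.comp y (hasFDerivAt_prodMk_left y θ)

theorem contDiff_intervalIntegral {F : V × ℝ → W} (hF : ContDiff ℝ ∞ F) :
    ContDiff ℝ ∞ fun y => ∫ θ in (0 : ℝ)..1, F (y, θ) := by
  have hfinite : ∀ (n : ℕ) (W : Type u) [NormedAddCommGroup W] [NormedSpace ℝ W] (F : V × ℝ → W),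
      ContDiff ℝ ∞ F → ContDiff ℝ n fun y => ∫ θ in (0 : ℝ)..1, F (y, θ) := by
    intro n
    induction n with
    | zero =>
      intro W _ _ F hF
      exact contDiff_zero.2 (continuous_iff_continuousAt.2 fun y =>
        (hasFDerivAt_intervalIntegral_of_contDiff (hF.of_le (by simp)) y).continuousAt)
    | succ n ih =>
      intro W _ _ F hF
      exact contDiff_succ_iff_hasFDerivAt.2
        ⟨_, ih _ _ ((hF.fderiv_right (m := ∞) (by simp)).clm_comp contDiff_const),
          hasFDerivAt_intervalIntegral_of_contDiff (hF.of_le (by simp))⟩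
  exact contDiff_infty.2 fun n => hfinite n W F hF

end ParametricIntegral

section Potentials

variable {d : ℕ} {A : E d → E d}

theorem contDiff_avgA (hA : ContDiff ℝ ∞ A) (x : E d) : ContDiff ℝ ∞ fun y => avgA A x (x + y) :=
  contDiff_intervalIntegral (F := fun p : E d × ℝ => A ((1 - p.2) • x + p.2 • (x + p.1)))
    (hA.comp (by fun_prop))

theorem contDiff_midA (hA : ContDiff ℝ ∞ A) (x : E d) : ContDiff ℝ ∞ fun y => midA A x (x + y) :=
  hA.comp (by fun_prop)

theorem contDiff_gauge (hA : ContDiff ℝ ∞ A) (φ : 𝓢(E d, ℝ)) : ContDiff ℝ ∞ (gauge A φ) :=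
  hA.add (contDiff_gradient φ)

/-! ### Gauge covariance with the averaged potential -/

theorem avgA_add {A' : E d → E d} (hA : Continuous A) (hA' : Continuous A') (x y : E d) :
    avgA (fun z => A z + A' z) x y = avgA A x y + avgA A' x y :=
  intervalIntegral.integral_add (Continuous.intervalIntegrable (by fun_prop) _ _)
    (Continuous.intervalIntegrable (by fun_prop) _ _)

theorem inner_avgA_gradient {φ : E d → ℝ} (hφ : ContDiff ℝ 1 φ) (x y : E d) :
    ⟪y - x, avgA (gradient φ) x y⟫_ℝ = φ y - φ x := by
  set l : ℝ → E d := fun θ => (1 - θ) • x + θ • y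
  have hl : Continuous l := by fun_prop
  have hgrad : Continuous fun θ => gradient φ (l θ) :=
    ((InnerProductSpace.toDual ℝ (E d)).symm.continuous.comp
      (hφ.continuous_fderiv one_ne_zero)).comp hl
  have hderiv : ∀ θ, HasDerivAt (φ ∘ l) ⟪y - x, gradient φ (l θ)⟫_ℝ θ := fun θ => by
    have hline : HasDerivAt l (y - x) θ := by
      have hl_eq : l = fun θ => x + θ • (y - x) := by
        funext θ
        module
      rw [hl_eq]
      simpa only [one_smul, id] using ((hasDerivAt_id θ).smul_const (y - x)).const_add x
    rw [real_inner_comm, gradient, InnerProductSpace.toDual_symm_apply]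
    exact (hφ.differentiable one_ne_zero (l θ)).hasFDerivAt.comp_hasDerivAt θ hline
  calc ⟪y - x, avgA (gradient φ) x y⟫_ℝ
      = ∫ θ in (0 : ℝ)..1, ⟪y - x, gradient φ (l θ)⟫_ℝ :=
        ((innerSL ℝ (y - x)).intervalIntegral_comp_comm (hgrad.intervalIntegrable 0 1)).symm
    _ = φ (l 1) - φ (l 0) := intervalIntegral.integral_eq_sub_of_hasDerivAt (fun θ _ => hderiv θ)
        ((continuous_const.inner hgrad).intervalIntegrable _ _)
    _ = φ y - φ x := by simp [l]

theorem inner_avgA_gauge (hA : Continuous A) (φ : 𝓢(E d, ℝ)) (x y : E d) :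
    ⟪y, avgA (gauge A φ) x (x + y)⟫_ℝ = ⟪y, avgA A x (x + y)⟫_ℝ + (φ (x + y) - φ x) := by
  have hφ := inner_avgA_gradient (φ.smooth 1) x (x + y)
  rw [add_sub_cancel_left] at hφ
  rw [← hφ, ← inner_add_right, ← avgA_add hA (contDiff_gradient φ).continuous]
  rfl

theorem H2_gauge (m : ℝ) (hA : ContDiff ℝ ∞ A) (φ : 𝓢(E d, ℝ)) {f : E d → ℂ} (hf : IsTest f) :
    H2 m (gauge A φ) f = mulPhase φ (H2 m A (mulPhase (-φ) f)) := by
  funext x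
  rw [mulPhase, H2, H2, pseudoDiff_eq m (contDiff_avgA (contDiff_gauge hA φ) x) hf,
    pseudoDiff_eq m (contDiff_avgA hA x) (hf.mulPhase (-φ)), ← sqrtLaplaceAtZero_const_mul]
  congr 1
  funext y
  have hphase : -I * ((⟪y, avgA (gauge A φ) x (x + y)⟫_ℝ : ℝ) : ℂ) =
      I * φ x + (-I * ((⟪y, avgA A x (x + y)⟫_ℝ : ℝ) : ℂ) + I * ((-φ) (x + y) : ℝ)) := by
    rw [inner_avgA_gauge hA.continuous, _root_.neg_apply]
    push_cast
    ring
  simp only [twist, mulPhase]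
  rw [hphase, Complex.exp_add, Complex.exp_add]
  ring

end Potentials

/-! ### Subordination to the heat semigroup -/

/-- The kernel `(1 - e^{-ts}) t^{-3/2}`, whose integral over `t > 0` is a multiple of `√s`. -/
def subKernel (s t : ℝ) : ℝ := (1 - Real.exp (-(t * s))) * t ^ (-(3 / 2) : ℝ)

theorem subKernel_nonneg {s t : ℝ} (hs : 0 ≤ s) (ht : 0 ≤ t) : 0 ≤ subKernel s t :=
  mul_nonneg (sub_nonneg.2 (Real.exp_le_one_iff.2 (neg_nonpos.2 (mul_nonneg ht hs))))
    (Real.rpow_nonneg ht _)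

theorem measurable_subKernel : Measurable fun p : ℝ × ℝ => subKernel p.1 p.2 := by
  unfold subKernel
  fun_prop

theorem subKernel_one_le_rpow_neg_half {t : ℝ} (ht : 0 < t) :
    subKernel 1 t ≤ t ^ (-(1 / 2) : ℝ) := by
  calc subKernel 1 t ≤ t * t ^ (-(3 / 2) : ℝ) := by
        refine mul_le_mul_of_nonneg_right ?_ (Real.rpow_nonneg ht.le _)
        linarith [Real.add_one_le_exp (-(t * 1))]
    _ = t ^ (-(1 / 2) : ℝ) := by
        rw [← Real.rpow_one_add' ht.le (by norm_num)]
        norm_num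

theorem subKernel_le_rpow (s : ℝ) {t : ℝ} (ht : 0 ≤ t) : subKernel s t ≤ t ^ (-(3 / 2) : ℝ) :=
  mul_le_of_le_one_left (Real.rpow_nonneg ht _) (sub_le_self _ (Real.exp_pos _).le)

theorem integrableOn_subKernel_one : IntegrableOn (subKernel 1) (Set.Ioi 0) := by
  have hmeas : Measurable (subKernel 1) := measurable_subKernel.comp measurable_prodMk_left
  have hnorm : ∀ {t : ℝ}, 0 < t → ‖subKernel 1 t‖ = subKernel 1 t := fun ht =>
    Real.norm_of_nonneg (subKernel_nonneg zero_le_one ht.le)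
  have hnear : IntegrableOn (fun t : ℝ => t ^ (-(1 / 2) : ℝ)) (Set.Ioc 0 1) :=
    (intervalIntegrable_iff_integrableOn_Ioc_of_le zero_le_one).1
      (intervalIntegral.intervalIntegrable_rpow' (by norm_num))
  have hfar : IntegrableOn (fun t : ℝ => t ^ (-(3 / 2) : ℝ)) (Set.Ioi 1) :=
    integrableOn_Ioi_rpow_of_lt (by norm_num) one_pos
  rw [← Set.Ioc_union_Ioi_eq_Ioi (zero_le_one' ℝ)]
  refine IntegrableOn.union
    (Integrable.mono' hnear hmeas.aestronglyMeasurable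
      (ae_restrict_of_forall_mem measurableSet_Ioc fun t ht => ?_))
    (Integrable.mono' hfar hmeas.aestronglyMeasurable
      (ae_restrict_of_forall_mem measurableSet_Ioi fun t ht => ?_))
  · exact (hnorm ht.1).trans_le (subKernel_one_le_rpow_neg_half ht.1)
  · have ht0 : 0 < t := one_pos.trans ht
    exact (hnorm ht0).trans_le (subKernel_le_rpow 1 ht0.le)

theorem subKernel_eq_scale {s t : ℝ} (hs : 0 < s) (ht : 0 < t) :
    subKernel s t = s ^ (3 / 2 : ℝ) * subKernel 1 (s * t) := by
  have hs' : s ^ (3 / 2 : ℝ) ≠ 0 := (Real.rpow_pos_of_pos hs _).ne'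
  rw [subKernel, subKernel, Real.mul_rpow hs.le ht.le, Real.rpow_neg hs.le]
  field_simp

theorem integrableOn_subKernel {s : ℝ} (hs : 0 ≤ s) : IntegrableOn (subKernel s) (Set.Ioi 0) := by
  rcases hs.eq_or_lt with rfl | hs
  · have hzero : subKernel 0 = fun _ => 0 := by
      funext t
      simp [subKernel]
    rw [hzero]
    exact integrableOn_zero
  · have hscaled : IntegrableOn (fun t => subKernel 1 (s * t)) (Set.Ioi 0) := by
      rw [integrableOn_Ioi_comp_mul_left_iff _ _ hs, mul_zero]
      exact integrableOn_subKernel_one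
    exact IntegrableOn.congr_fun (hscaled.const_mul (s ^ (3 / 2 : ℝ)))
      (fun t ht => (subKernel_eq_scale hs ht).symm) measurableSet_Ioi

theorem integral_subKernel {s : ℝ} (hs : 0 ≤ s) :
    ∫ t in Set.Ioi 0, subKernel s t = √s * ∫ t in Set.Ioi 0, subKernel 1 t := by
  rcases hs.eq_or_lt with rfl | hs
  · simp [subKernel]
  · rw [setIntegral_congr_fun measurableSet_Ioi fun t ht => subKernel_eq_scale hs ht,
      integral_const_mul, integral_comp_mul_left_Ioi (subKernel 1) 0 hs, mul_zero, smul_eq_mul,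
      ← mul_assoc, Real.sqrt_eq_rpow]
    congr 1
    rw [← Real.rpow_neg_one s, ← Real.rpow_add hs]
    norm_num

section Nonlocality

variable {V : Type*} [NormedAddCommGroup V] [InnerProductSpace ℝ V]

/-- The kernel `(4πt)^{-n/2} e^{-|y|²/(4t)}` of the heat semigroup `e^{tΔ}` on an `n`-dimensional
space, at the points `0` and `y`. -/
def heatKernel (t : ℝ) (y : V) : ℝ :=
  (4 * Real.pi * t) ^ (-(Module.finrank ℝ V / 2) : ℝ) * Real.exp (-(‖y‖ ^ 2 / (4 * t)))

theorem heatKernel_pos {t : ℝ} (ht : 0 < t) (y : V) : 0 < heatKernel t y := by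
  unfold heatKernel
  positivity

theorem continuous_heatKernel (t : ℝ) : Continuous (heatKernel t : V → ℝ) := by
  unfold heatKernel
  fun_prop

theorem heatKernel_le {t : ℝ} (ht : 0 < t) (y : V) :
    heatKernel t y ≤ (4 * Real.pi * t) ^ (-(Module.finrank ℝ V / 2) : ℝ) :=
  mul_le_of_le_one_right (by positivity)
    (Real.exp_le_one_iff.2 (neg_nonpos.2 (by positivity)))

variable [FiniteDimensional ℝ V] [MeasurableSpace V] [BorelSpace V]

theorem fourier_exp_neg_mul_sq {t : ℝ} (ht : 0 < t) :
    𝓕 (fun w : V => ((Real.exp (-(t * (2 * Real.pi * ‖w‖) ^ 2)) : ℝ) : ℂ)) =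
      fun y => (heatKernel t y : ℂ) := by
  have hb : 0 < ((4 * Real.pi ^ 2 * t : ℝ) : ℂ).re := by
    rw [ofReal_re]
    positivity
  have hgauss : (fun w : V => ((Real.exp (-(t * (2 * Real.pi * ‖w‖) ^ 2)) : ℝ) : ℂ)) =
      fun w => cexp (-((4 * Real.pi ^ 2 * t : ℝ) : ℂ) * ‖w‖ ^ 2) := by
    funext w
    push_cast
    ring_nf
  funext y
  have hbase : (Real.pi : ℂ) / ((4 * Real.pi ^ 2 * t : ℝ) : ℂ) = ((4 * Real.pi * t)⁻¹ : ℝ) := by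
    rw [← ofReal_div]
    congr 1
    field_simp
  have hexponent : -(Real.pi : ℂ) ^ 2 * ‖y‖ ^ 2 / ((4 * Real.pi ^ 2 * t : ℝ) : ℂ) =
      (-(‖y‖ ^ 2 / (4 * t)) : ℝ) := by
    have hreal : -Real.pi ^ 2 * ‖y‖ ^ 2 / (4 * Real.pi ^ 2 * t) = -(‖y‖ ^ 2 / (4 * t)) := by
      field_simp
    rw [← hreal]
    push_cast
    rfl
  rw [hgauss, fourier_gaussian_innerProductSpace hb, hbase, hexponent, heatKernel,
    Real.rpow_neg (by positivity), ← Real.inv_rpow (by positivity), ofReal_mul, ofReal_exp,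
    ofReal_cpow (by positivity)]
  push_cast
  rfl

theorem integrable_exp_neg_mul_sq {t : ℝ} (ht : 0 < t) :
    Integrable fun w : V => ((Real.exp (-(t * (2 * Real.pi * ‖w‖) ^ 2)) : ℝ) : ℂ) := by
  have hb : 0 < ((4 * Real.pi ^ 2 * t : ℝ) : ℂ).re := by
    rw [ofReal_re]
    positivity
  refine (GaussianFourier.integrable_cexp_neg_mul_sq_norm_add hb 0 (0 : V)).congr
    (ae_of_all _ fun w => ?_)
  push_cast
  ring_nf

theorem integral_exp_neg_mul_sq_mul_fourier {t : ℝ} (ht : 0 < t) {g : V → ℂ}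
    (hg : Integrable g) :
    ∫ w, ((Real.exp (-(t * (2 * Real.pi * ‖w‖) ^ 2)) : ℝ) : ℂ) * 𝓕 g w =
      ∫ y, (heatKernel t y : ℂ) * g y := by
  simp only [← congrFun (fourier_exp_neg_mul_sq ht)]
  simpa using! (VectorFourier.integral_fourierIntegral_smul_eq_flip (L := innerₗ V)
    Real.continuous_fourierChar continuous_inner (integrable_exp_neg_mul_sq ht) hg).symm

theorem integral_fourier_eq (g : 𝓢(V, ℂ)) : ∫ w, 𝓕 (g : V → ℂ) w = g 0 := by
  have hinv := congrFun
    (g.continuous.fourierInv_fourier_eq g.integrable (𝓕 g : 𝓢(V, ℂ)).integrable) 0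
  rw [Real.fourierInv_eq'] at hinv
  simpa using hinv

theorem continuous_fourier (g : 𝓢(V, ℂ)) : Continuous (𝓕 (g : V → ℂ)) :=
  (𝓕 g : 𝓢(V, ℂ)).continuous

theorem integrable_sqrtSymbol_mul_fourier (m : ℝ) (g : 𝓢(V, ℂ)) :
    Integrable fun w : V => sqrtSymbol m w * ‖𝓕 (g : V → ℂ) w‖ := by
  obtain ⟨M, hM⟩ := exists_norm_fourier_le g (Module.finrank ℝ V + 2)
  refine (integrable_sqrtSymbol_mul_decay m M).mono'
    ((continuous_sqrtSymbol m).mul (continuous_fourier g).norm).aestronglyMeasurable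
    (ae_of_all _ fun w => ?_)
  rw [norm_mul, norm_norm, Real.norm_of_nonneg (sqrtSymbol_nonneg m w)]
  exact mul_le_mul_of_nonneg_left (hM w) (sqrtSymbol_nonneg m w)

theorem integrable_subKernel_mul_fourier (m : ℝ) (g : 𝓢(V, ℂ)) :
    Integrable (Function.uncurry fun (w : V) (t : ℝ) =>
      (subKernel (sqrtSymbol m w ^ 2) t : ℂ) * 𝓕 (g : V → ℂ) w)
      (volume.prod (volume.restrict (Set.Ioi 0))) := by
  have hmeas : Measurable (Function.uncurry fun (w : V) (t : ℝ) =>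
      (subKernel (sqrtSymbol m w ^ 2) t : ℂ) * 𝓕 (g : V → ℂ) w) := by
    have hsymbol : Measurable fun p : V × ℝ => (sqrtSymbol m p.1 ^ 2, p.2) :=
      (((continuous_sqrtSymbol m).measurable.comp measurable_fst).pow_const 2).prodMk measurable_snd
    exact (measurable_ofReal.comp (measurable_subKernel.comp hsymbol)).mul
      ((continuous_fourier g).measurable.comp measurable_fst)
  refine (integrable_prod_iff hmeas.aestronglyMeasurable).2 ⟨ae_of_all _ fun w => ?_, ?_⟩
  · have hint : Integrable (fun t => (subKernel (sqrtSymbol m w ^ 2) t : ℂ))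
        (volume.restrict (Set.Ioi 0)) := (integrableOn_subKernel (sq_nonneg _)).ofReal
    exact hint.mul_const (𝓕 (g : V → ℂ) w)
  · refine ((integrable_sqrtSymbol_mul_fourier m g).const_mul
      (∫ t in Set.Ioi (0 : ℝ), subKernel 1 t)).congr (ae_of_all _ fun w => ?_)
    have hnorm : ∫ t in Set.Ioi (0 : ℝ), ‖(subKernel (sqrtSymbol m w ^ 2) t : ℂ)‖ =
        sqrtSymbol m w * ∫ t in Set.Ioi (0 : ℝ), subKernel 1 t := by
      conv_rhs => rw [← Real.sqrt_sq (sqrtSymbol_nonneg m w), ← integral_subKernel (sq_nonneg _)]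
      refine setIntegral_congr_fun measurableSet_Ioi fun t ht => ?_
      rw [norm_real, Real.norm_of_nonneg (subKernel_nonneg (sq_nonneg _) (le_of_lt ht))]
    simp only [Function.uncurry_apply_pair, norm_mul]
    rw [integral_mul_const, hnorm]
    ring

theorem integral_subKernel_mul_fourier (m : ℝ) (g : 𝓢(V, ℂ)) {t : ℝ} (ht : 0 < t) :
    ∫ w, (subKernel (sqrtSymbol m w ^ 2) t : ℂ) * 𝓕 (g : V → ℂ) w =
      (t ^ (-(3 / 2) : ℝ) : ℝ) *
        (g 0 - (Real.exp (-(t * m ^ 2)) : ℝ) * ∫ y, (heatKernel t y : ℂ) * g y) := by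
  have hfourier : Integrable (𝓕 (g : V → ℂ)) := (𝓕 g : 𝓢(V, ℂ)).integrable
  have hdamped : Integrable fun w : V =>
      ((Real.exp (-(t * (2 * Real.pi * ‖w‖) ^ 2)) : ℝ) : ℂ) * 𝓕 (g : V → ℂ) w := by
    refine hfourier.bdd_mul (c := 1) (by fun_prop) (ae_of_all _ fun w => ?_)
    rw [norm_real, Real.norm_of_nonneg (Real.exp_nonneg _), Real.exp_le_one_iff]
    exact neg_nonpos.2 (by positivity)
  have hsplit : ∀ w : V, (subKernel (sqrtSymbol m w ^ 2) t : ℂ) * 𝓕 (g : V → ℂ) w =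
      (t ^ (-(3 / 2) : ℝ) : ℝ) * (𝓕 (g : V → ℂ) w - (Real.exp (-(t * m ^ 2)) : ℝ) *
        ((Real.exp (-(t * (2 * Real.pi * ‖w‖) ^ 2)) : ℝ) * 𝓕 (g : V → ℂ) w)) := fun w => by
    rw [subKernel, sqrtSymbol, Real.sq_sqrt (by positivity), mul_add, neg_add, Real.exp_add]
    push_cast
    ring
  simp only [hsplit]
  rw [integral_const_mul, integral_sub hfourier (hdamped.const_mul _), integral_const_mul,
    integral_exp_neg_mul_sq_mul_fourier ht g.integrable, integral_fourier_eq]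

theorem integral_subKernel_mul_sqrtLaplaceAtZero (m : ℝ) (g : 𝓢(V, ℂ)) :
    ((∫ t in Set.Ioi (0 : ℝ), subKernel 1 t : ℝ) : ℂ) * sqrtLaplaceAtZero m g =
      ∫ t in Set.Ioi (0 : ℝ), ∫ w, (subKernel (sqrtSymbol m w ^ 2) t : ℂ) * 𝓕 (g : V → ℂ) w := by
  rw [← integral_integral_swap (integrable_subKernel_mul_fourier m g), sqrtLaplaceAtZero,
    ← integral_const_mul]
  refine integral_congr_ae (ae_of_all _ fun w => ?_)
  simp only
  rw [integral_mul_const, integral_complex_ofReal, integral_subKernel (sq_nonneg _),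
    Real.sqrt_sq (sqrtSymbol_nonneg m w)]
  push_cast
  ring

theorem integral_heatKernel_mul_pos {u : 𝓢(V, ℝ)} (hu : ∀ y, 0 ≤ u y) (hne : u ≠ 0) {t : ℝ}
    (ht : 0 < t) : 0 < ∫ y, heatKernel t y * u y := by
  obtain ⟨y₀, hy₀⟩ := DFunLike.ne_iff.1 hne
  refine integral_pos_of_integrable_nonneg_nonzero (x := y₀)
    ((continuous_heatKernel t).mul u.continuous) ?_
    (fun y => mul_nonneg (heatKernel_pos ht y).le (hu y))
    (mul_ne_zero (heatKernel_pos ht y₀).ne' hy₀)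
  exact u.integrable.bdd_mul (continuous_heatKernel t).aestronglyMeasurable (ae_of_all _ fun y =>
    (Real.norm_of_nonneg (heatKernel_pos ht y).le).trans_le (heatKernel_le ht y))

/-- `√(-Δ + m²)` is not local: its kernel is negative off the diagonal, since that of `e^{tΔ}` is
positive. -/
theorem sqrtLaplaceAtZero_ne_zero (m : ℝ) {u : 𝓢(V, ℝ)} (hu : ∀ y, 0 ≤ u y) (hu0 : u 0 = 0)
    (hne : u ≠ 0) : sqrtLaplaceAtZero m (fun y => (u y : ℂ)) ≠ 0 := by
  set g : 𝓢(V, ℂ) := u.postcompCLM ofRealCLM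
  have hg : ∀ y, g y = (u y : ℂ) := fun y => rfl
  set q : ℝ → ℝ := fun t =>
    t ^ (-(3 / 2) : ℝ) * (Real.exp (-(t * m ^ 2)) * ∫ y, heatKernel t y * u y)
  have hqpos : ∀ t ∈ Set.Ioi (0 : ℝ), 0 < q t := fun t ht =>
    mul_pos (Real.rpow_pos_of_pos ht _)
      (mul_pos (Real.exp_pos _) (integral_heatKernel_mul_pos hu hne ht))
  have hslice : ∀ t ∈ Set.Ioi (0 : ℝ),
      ∫ w, (subKernel (sqrtSymbol m w ^ 2) t : ℂ) * 𝓕 (g : V → ℂ) w = ((-q t : ℝ) : ℂ) := by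
    intro t ht
    simp only [integral_subKernel_mul_fourier m g ht, hg, hu0, ← ofReal_mul,
      integral_complex_ofReal, q]
    push_cast
    ring
  have hqint : IntegrableOn q (Set.Ioi 0) := by
    have hneg : IntegrableOn (fun t => ((-q t : ℝ) : ℂ)) (Set.Ioi 0) :=
      IntegrableOn.congr_fun (integrable_subKernel_mul_fourier m g).integral_prod_right hslice
        measurableSet_Ioi
    simpa [IntegrableOn] using (Integrable.re hneg).neg
  have hqintegral : 0 < ∫ t in Set.Ioi (0 : ℝ), q t := by
    rw [setIntegral_pos_iff_support_of_nonneg_ae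
      (ae_restrict_of_forall_mem measurableSet_Ioi fun t ht => (hqpos t ht).le) hqint,
      Set.inter_eq_right.2 fun t ht => Function.mem_support.2 (hqpos t ht).ne']
    simp
  have hsub := integral_subKernel_mul_sqrtLaplaceAtZero m g
  rw [setIntegral_congr_fun measurableSet_Ioi hslice, integral_complex_ofReal, integral_neg] at hsub
  intro hzero
  have hg_eq : sqrtLaplaceAtZero m g = 0 := hzero
  rw [hg_eq, mul_zero] at hsub
  exact hqintegral.ne' (neg_eq_zero.1 (ofReal_eq_zero.1 hsub.symm))

end Nonlocality

/-! ### Failure of gauge covariance with the midpoint potential -/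

theorem cexp_neg_I_ne_one : cexp (-I) ≠ 1 := by
  intro h
  have hcos : Real.cos 1 = 1 := by simpa [Complex.exp_re] using congrArg re h
  linarith [Real.cos_one_le]

section Bumps

variable {V : Type*} [NormedAddCommGroup V] [InnerProductSpace ℝ V] [FiniteDimensional ℝ V]

theorem gradient_eq_zero_of_notMem_tsupport {φ : V → ℝ} {z : V} (hz : z ∉ tsupport φ) :
    gradient φ z = 0 := by
  have hfderiv : fderiv ℝ φ z = 0 :=
    image_eq_zero_of_notMem_tsupport fun h => hz (tsupport_fderiv_subset ℝ h)
  rw [gradient, hfderiv, map_zero]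

/-- The gauge function `φ` is constant where `u` lives, while its gradient is invisible at the
midpoints between the origin and the support of `u`. -/
theorem exists_schwartz_gradient_half_eq_zero [Nontrivial V] : ∃ φ u : 𝓢(V, ℝ),
    HasCompactSupport u ∧ (∀ y, 0 ≤ u y) ∧ u 0 = 0 ∧ u ≠ 0 ∧ φ 0 = 0 ∧
      ∀ y, u y ≠ 0 → φ y = 1 ∧ gradient φ ((1 / 2 : ℝ) • y) = 0 := by
  obtain ⟨y₀, hy₀⟩ := exists_norm_eq V zero_le_one
  let b : ContDiffBump y₀ := ⟨1 / 4, 1 / 3, by norm_num, by norm_num⟩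
  let c : ContDiffBump y₀ := ⟨1 / 8, 1 / 4, by norm_num, by norm_num⟩
  let φ : 𝓢(V, ℝ) := b.hasCompactSupport.toSchwartzMap b.contDiff
  let u : 𝓢(V, ℝ) := c.hasCompactSupport.toSchwartzMap c.contDiff
  have hdist : dist 0 y₀ = 1 := by rw [dist_zero_left, hy₀]
  have huy₀ : u y₀ = 1 := c.one_of_mem_closedBall (Metric.mem_closedBall_self c.rIn_pos.le)
  refine ⟨φ, u, c.hasCompactSupport, fun y => c.nonneg, c.zero_of_le_dist ?_, fun h => ?_,
    b.zero_of_le_dist ?_, fun y hy => ?_⟩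
  · rw [hdist]
    norm_num [c]
  · simp [h] at huy₀
  · rw [hdist]
    norm_num [b]
  · have hyball : y ∈ Metric.ball y₀ (1 / 4) := c.support_eq ▸ Function.mem_support.2 hy
    refine ⟨b.one_of_mem_closedBall (Metric.ball_subset_closedBall hyball),
      gradient_eq_zero_of_notMem_tsupport fun hmem => ?_⟩
    have hfar : ‖(1 / 2 : ℝ) • y - y₀‖ ≤ 1 / 3 := by
      rw [← dist_eq_norm, ← Metric.mem_closedBall]
      exact b.tsupport_eq ▸ hmem
    have hnear : ‖(1 / 2 : ℝ) • (y - y₀)‖ ≤ 1 / 8 := by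
      rw [norm_smul, ← dist_eq_norm]
      norm_num
      linarith [Metric.mem_ball.1 hyball]
    have hhalf : ‖(1 / 2 : ℝ) • y₀‖ = 1 / 2 := by
      rw [norm_smul, hy₀]
      norm_num
    have hsub := norm_sub_le ((1 / 2 : ℝ) • (y - y₀)) ((1 / 2 : ℝ) • y - y₀)
    rw [show (1 / 2 : ℝ) • (y - y₀) - ((1 / 2 : ℝ) • y - y₀) = (1 / 2 : ℝ) • y₀ by module,
      hhalf] at hsub
    linarith

end Bumps

section Midpoint

variable {d : ℕ} {A : E d → E d}

theorem H1_apply_zero (m : ℝ) (hA : ContDiff ℝ ∞ A) {f : E d → ℂ} (hf : IsTest f) :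
    H1 m A f 0 = sqrtLaplaceAtZero m (twist (midA A 0) f) := by
  have heq := pseudoDiff_eq m (contDiff_midA hA 0) hf
  simp only [zero_add] at heq
  exact heq

/-- The function `e^{i⟨y, B(y)⟩} F(y)`, which `twist B` takes to `F`. -/
def untwist (B : E d → E d) (F : E d → ℂ) : E d → ℂ :=
  fun y => cexp (I * ((⟪y, B y⟫_ℝ : ℝ) : ℂ)) * F y

theorem IsTest.untwist {B : E d → E d} (hB : ContDiff ℝ ∞ B) {F : E d → ℂ} (hF : IsTest F) :
    IsTest (MagRel.untwist B F) :=
  hF.mul_left (contDiff_const.mul (ofRealCLM.contDiff.comp (contDiff_id.inner ℝ hB))).cexp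

theorem twist_untwist_apply {B B' : E d → E d} {F : E d → ℂ} {y : E d} (h : B' y = B y) :
    twist B' (untwist B F) y = F y := by
  rw [twist, untwist, h, ← mul_assoc, ← Complex.exp_add]
  simp

theorem isTest_untwist_midA (hA : ContDiff ℝ ∞ A) {u : 𝓢(E d, ℝ)} (hu : HasCompactSupport u) :
    IsTest (untwist (midA A 0) fun y => (u y : ℂ)) := by
  have hmid : ContDiff ℝ ∞ (midA A 0) := by simpa only [zero_add] using contDiff_midA hA 0
  exact IsTest.untwist hmid
    ⟨ofRealCLM.contDiff.comp (u.smooth ⊤), hu.comp_left (g := fun t : ℝ => (t : ℂ)) ofReal_zero⟩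

theorem H1_gauge_untwist_ne (m : ℝ) (hA : ContDiff ℝ ∞ A) {φ u : 𝓢(E d, ℝ)}
    (huc : HasCompactSupport u) (hu : ∀ y, 0 ≤ u y) (hu0 : u 0 = 0) (hne : u ≠ 0) (hφ0 : φ 0 = 0)
    (hφ : ∀ y, u y ≠ 0 → φ y = 1 ∧ gradient φ ((1 / 2 : ℝ) • y) = 0) :
    H1 m (gauge A φ) (untwist (midA A 0) fun y => (u y : ℂ)) ≠
      mulPhase φ (H1 m A (mulPhase (-φ) (untwist (midA A 0) fun y => (u y : ℂ)))) := by
  set f := untwist (midA A 0) fun y => (u y : ℂ)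
  have hf : IsTest f := isTest_untwist_midA hA huc
  have hleft : twist (midA (gauge A φ) 0) f = fun y => (u y : ℂ) := by
    funext y
    by_cases hy : u y = 0
    · simp [twist, f, untwist, hy]
    · refine twist_untwist_apply ?_
      simp only [midA, gauge, zero_add, (hφ y hy).2, add_zero]
  have hright : twist (midA A 0) (mulPhase (-φ) f) = fun y => cexp (-I) * (u y : ℂ) := by
    funext y
    by_cases hy : u y = 0
    · simp [twist, mulPhase, f, untwist, hy]
    · rw [← twist_untwist_apply (B := midA A 0) (F := fun y => (u y : ℂ)) rfl, twist, twist,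
        mulPhase, _root_.neg_apply, (hφ y hy).1, mul_left_comm]
      simp [f]
  intro h
  have hzero := congrFun h 0
  rw [mulPhase, hφ0, ofReal_zero, mul_zero, Complex.exp_zero, one_mul,
    H1_apply_zero m (contDiff_gauge hA φ) hf, H1_apply_zero m hA (hf.mulPhase (-φ)), hleft, hright,
    sqrtLaplaceAtZero_const_mul, eq_comm, mul_eq_right₀ (sqrtLaplaceAtZero_ne_zero m hu hu0 hne)]
    at hzero
  exact cexp_neg_I_ne_one hzero

theorem exists_H1_gauge_ne (m : ℝ) (hd : 0 < d) (hA : ContDiff ℝ ∞ A) :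
    ∃ φ : 𝓢(E d, ℝ), ∃ f : E d → ℂ, IsTest f ∧
      H1 m (gauge A φ) f ≠ mulPhase φ (H1 m A (mulPhase (-φ) f)) := by
  have : Nonempty (Fin d) := ⟨⟨0, hd⟩⟩
  obtain ⟨φ, u, huc, hu, hu0, hne, hφ0, hφ⟩ := exists_schwartz_gradient_half_eq_zero (V := E d)
  exact ⟨φ, _, isTest_untwist_midA hA huc, H1_gauge_untwist_ne m hA huc hu hu0 hne hφ0 hφ⟩

end Midpoint

end MagRel

end

open MagRel in
theorem proposition2p8_general (d : ℕ) (m : ℝ) :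
    (∀ A : E d → E d, ContDiff ℝ ∞ A → ∀ f : E d → ℂ, IsTest f → ∀ x : E d,
      (∃ L, HasOscIntegral (amplitude m (midA A) f x) L) ∧
      (∃ L, HasOscIntegral (amplitude m (avgA A) f x) L)) ∧
    (∀ A : E d → E d, IsL2Loc A →
      ∃! S : L2 d →ₗ.[ℂ] L2 d, IsNonnegSqrt S (magGraph m A)) ∧
    (∀ A : E d → E d, ContDiff ℝ ∞ A → ∀ φ : SchwartzMap (E d) ℝ,
      ∀ f : E d → ℂ, IsTest f →
        H2 m (gauge A φ) f = mulPhase φ (H2 m A (mulPhase (-φ) f))) ∧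
    (∀ A : E d → E d, IsL2Loc A → ∀ φ : SchwartzMap (E d) ℝ,
      H3 m (gauge A φ) = gaugeConj φ (H3 m A)) ∧
    (0 < d → ∀ A : E d → E d, ContDiff ℝ ∞ A → ∃ φ : SchwartzMap (E d) ℝ,
      ∃ f : E d → ℂ, IsTest f ∧
        H1 m (gauge A φ) f ≠ mulPhase φ (H1 m A (mulPhase (-φ) f))) :=
  ⟨fun _ hA _ hf x =>
      ⟨⟨_, hasOscIntegral_amplitude m (contDiff_midA hA x) hf⟩,
        ⟨_, hasOscIntegral_amplitude m (contDiff_avgA hA x) hf⟩⟩,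
    fun _ hA => existsUnique_isNonnegSqrt m hA,
    fun _ hA φ _ hf => H2_gauge m hA φ hf,
    fun _ hA φ => H3_gauge m hA φ,
    fun hd _ hA => exists_H1_gauge_ne m hd hA⟩

open MagRel in
theorem proposition2p8 (d : ℕ) (m : ℝ) (hm : 0 ≤ m) :
    -- the oscillatory integrals that define `H_A^{(1)} f` and `H_A^{(2)} f` exist
    (∀ A : E d → E d, IsTemperate A → ∀ f : E d → ℂ, IsTest f → ∀ x : E d,
      (∃ L, HasOscIntegral (amplitude m (midA A) f x) L) ∧
      (∃ L, HasOscIntegral (amplitude m (avgA A) f x) L)) ∧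
    -- the nonnegative selfadjoint square root that defines `H_A^{(3)}` exists and is unique
    (∀ A : E d → E d, IsL2Loc A →
      ∃! S : L2 d →ₗ.[ℂ] L2 d, IsNonnegSqrt S (magGraph m A)) ∧
    -- gauge covariance of `H_A^{(2)}`
    (∀ A : E d → E d, IsTemperate A → ∀ φ : SchwartzMap (E d) ℝ,
      ∀ f : E d → ℂ, IsTest f →
        H2 m (gauge A φ) f = mulPhase φ (H2 m A (mulPhase (-φ) f))) ∧
    -- gauge covariance of `H_A^{(3)}`
    (∀ A : E d → E d, IsL2Loc A → ∀ φ : SchwartzMap (E d) ℝ,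
      H3 m (gauge A φ) = gaugeConj φ (H3 m A)) ∧
    -- failure of gauge covariance for `H_A^{(1)}`
    (0 < d → ∀ A : E d → E d, IsTemperate A → ∃ φ : SchwartzMap (E d) ℝ,
      ∃ f : E d → ℂ, IsTest f ∧
        H1 m (gauge A φ) f ≠ mulPhase φ (H1 m A (mulPhase (-φ) f))) :=
  let ⟨exists_osc, existsUnique_sqrt, H2_gauge, H3_gauge, H1_gauge_ne⟩ := proposition2p8_general d m
  ⟨fun A hA => exists_osc A hA.1, existsUnique_sqrt, fun A hA => H2_gauge A hA.1, H3_gauge,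
    fun hd A hA => H1_gauge_ne hd A hA.1⟩
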